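/- Let $0<a<b<c$ be integers with $\gcd(a,b,c)=1$, let $T=\langle a,b,c\rangle=\{xa+yb+zc: x,y,z\in\mathbb N\}$, and for $m\in\mathbb N$ let the denumerant $\mathrm d(m,T)$ be the number of $(x,y,z)\in\mathbb N^3$ with $xa+yb+zc=m$. Time is the number of steps of a while program over integer registers, where each operation $+,-,\cdot$, division with remainder, each comparison (or conjunction of tests) and each assignment is one step. *Notions.* Label $(i,j)\in\mathbb N^2$ by the class of $ia+jb$ modulo $c$. An L-shape $\mathrm L(l,h,w,y)$ ($0\le w<l$, $0\le y<h$, $lh-wy=c$) is the set of all $(i,j)$ with $0\le i<l$, $0\le j<h$ and ($i<l-w$ or $j<h-y$). It is related to $T$ if it contains exactly one pair of each label, each pair $(i,j)$ in it minimizes $ia+jb$ among the pairs of $\mathbb N^2$ with its label, and $la\equiv yb$, $hb\equiv wa \pmod c$. Then put $\delta=(la-yb)/c$, $\theta=(hb-wa)/c$. The basic factorization of $m\in T$ is the $(x_0,y_0,z_0)\in\mathbb N^3$ with $x_0a+y_0b+z_0c=m$ and $(x_0,y_0)\in\mathrm L(l,h,w,y)$. For $0\le s,t<q$ and $N\ge0$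 put $S^{\pm}(s,t,q,N)=\sum_{k=0}^{N}\lfloor (s\pm kt)/q\rfloor$. *Algorithm.* Phase 1 computes, by Euclidean reduction of a basis of the lattice $\{(i,j)\in\mathbb Z^2: ia+jb\equiv0 \pmod c\}$, an L-shape related to $T$ and the pair $(x_0,y_0)$ in it with the label of $m$, and sets $z_0=(m-x_0a-y_0b)/c$. Phase 2 returns $0$ if $z_0<0$; otherwise, with $A=\lfloor z_0/(\delta+\theta)\rfloor$, it returns $$1+A+\sum_{k=0}^{A}(S_k+T_k),$$ where $$S_k=\min\left\{\left\lfloor\tfrac{y_0+k(h-y)}{y}\right\rfloor,\left\lfloor\tfrac{z_0-k(\delta+\theta)}{\delta}\right\rfloor\right\},\qquad T_k=\min\left\{\left\lfloor\tfrac{x_0+k(l-w)}{w}\right\rfloor,\left\lfloor\tfrac{z_0-k(\delta+\theta)}{\theta}\right\rfloor\right\},$$ and a term with denominator $0$ is omitted. It does so by splitting the sum of the $S_k$ at $k_1=\lceil (z_0y-y_0\delta)/a\rceil$ and that of the $T_k$ at $k_0=\lceil (z_0w-x_0\theta)/b\rceil$, which leaves closed expressions and at most four sums $S^{\pm}(s,t,q,N)$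 with $q\in\{y,w,\delta,\theta\}$. A sum $S^\pm(s,t,q,N)$ is $0$ if $t=0$; otherwise it is found by counting how often each value is taken: away from the ends a value is taken $\lfloor q/t\rfloor$ times or, if its index is of hS-type, once more. The indices of hS-type are periodic with period $\tilde t=t/\gcd(t,q)$; those of one period are enumerated. **Theorem.** There is an absolute constant $C$ such that, for all such $a,b,c$ and all $m\in\mathbb N$: 1. the algorithm halts with output $\mathrm d(m,T)$ after at most $C\,(b+\log c)$ steps; 2. phase 1 halts after at most $C\log c$ steps with an L-shape related to $T$ and, if $m\in T$, the basic factorization of $m$ with respect to it; 3. if $m\in T$, then phase 2, started with any L-shape related to $T$ and the basic factorization of $m$ with respect to it, halts with output $\mathrm d(m,T)$ after at most $C\,b$ steps; this includes the three cases $a>1$ with $c\notin\langle a,b\rangle$, $a>1$ with $c\in\langle a,b\rangle$, and $a=1$; 4. for $0\le s,t<q$ and $N\ge0$, the routines for $S^{+}(s,t,q,N)$ and $S^{-}(s,t,q,N)$ halt with the correct value after at most $C\,(t+1)$ steps. -/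

import Mathlib

namespace Denumerant

/-! ## Numerical 3-semigroups, denumerants, L-shapes -/

/-- The semigroup `⟨a, b, c⟩` of all non-negative integer combinations of `a, b, c`. -/
def semigroup (a b c : ℕ) : AddSubmonoid ℕ :=
  AddSubmonoid.closure {a, b, c}

/-- The set of factorizations of `m` with respect to the generators `a, b, c`. -/
def factorizations (m a b c : ℕ) : Set (ℕ × ℕ × ℕ) :=
  {x | x.1 * a + x.2.1 * b + x.2.2 * c = m}

/-- The denumerant of `m` in `⟨a, b, c⟩`: the number of factorizations. -/
noncomputable def denumerant (m a b c : ℕ) : ℕ :=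
  (factorizations m a b c).ncard

/-- A minimum distance diagram related to `⟨a, b, c⟩`. The unit square with lower left corner
`(s, t)` is represented by the pair `(s, t)` and is labelled by the class of `s a + t b`
modulo `c`. -/
structure IsMDD (a b c : ℕ) (H : Finset (ℕ × ℕ)) : Prop where
  card_eq : H.card = c
  exists_mem : ∀ n < c, ∃ p ∈ H, p.1 * a + p.2 * b ≡ n [MOD c]
  cone_subset : ∀ p ∈ H, ∀ i j : ℕ, i ≤ p.1 → j ≤ p.2 → (i, j) ∈ H
  minimal : ∀ p ∈ H, ∀ s t : ℕ,
    s * a + t * b ≡ p.1 * a + p.2 * b [MOD c] → p.1 * a + p.2 * b ≤ s * a + t * b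

/-- The unit squares of `L(l, h, w, y)`: an `l × h` rectangle from which a `w × y` rectangle is
removed at the upper right corner. -/
def cells (l h w y : ℕ) : Finset (ℕ × ℕ) :=
  (Finset.range l ×ˢ Finset.range h).filter fun p => p.1 + w < l ∨ p.2 + y < h

/-- `L(l, h, w, y)` is an L-shape related to `⟨a, b, c⟩`: its squares form a minimum distance
diagram, and the vectors `(l, -y)` and `(-w, h)` of its tessellation carry the label `0` modulo `c`
(for a rectangle, where `w = 0` or `y = 0`, the set of squares alone does not determine the
tessellation). -/
structure IsRelatedLShape (a b c l h w y : ℕ) : Prop where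
  w_lt : w < l
  y_lt : y < h
  area : l * h = w * y + c
  isMDD : IsMDD a b c (cells l h w y)
  u_label : l * a ≡ y * b [MOD c]
  v_label : h * b ≡ w * a [MOD c]

/-- `(x₀, y₀, z₀)` is the basic factorization of `m` with respect to `L(l, h, w, y)`. -/
def IsBasicFactorization (a b c l h w y m x₀ y₀ z₀ : ℕ) : Prop :=
  (x₀, y₀, z₀) ∈ factorizations m a b c ∧ (x₀, y₀) ∈ cells l h w y

/-! ## The machine model

While programs over finitely many integer registers, in the uniform cost model: every arithmetic
operation, every comparison and every assignment costs one step. -/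

/-- The registers. -/
inductive Reg
  -- input and output
  | a | b | c | m | out
  -- L-shape, basic factorization and related parameters
  | l | h | w | y | x0 | y0 | z0 | delta | theta | am
  -- extended Euclidean algorithm
  | r0 | r1 | s0 | s1 | quo | tmp | gac | inv
  -- reduction of the lattice basis and of the point
  | ex | fx | k | jn | jm | j1
  -- one of the two halves of the basic sum
  | p0 | side | width | dd | ee | gen | k1 | part | partY | alpha
  -- discrete sums
  | s | t | q | n | top | xtop | base | res | tt | qh | sh | o
  | i | j | off | j0 | jl | u | acc | accJ | corr
  deriving DecidableEq

/-- The contents of the registers. -/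
abbrev Store := Reg → ℤ

/-- Arithmetic expressions. -/
inductive Exp
  | lit (z : ℤ)
  | reg (x : Reg)
  | add (e f : Exp)
  | sub (e f : Exp)
  | mul (e f : Exp)
  | div (e f : Exp)
  | mod (e f : Exp)

instance : Coe Reg Exp := ⟨Exp.reg⟩
instance (k : ℕ) : OfNat Exp k := ⟨Exp.lit k⟩
instance : Add Exp := ⟨Exp.add⟩
instance : Sub Exp := ⟨Exp.sub⟩
instance : Mul Exp := ⟨Exp.mul⟩
instance : Div Exp := ⟨Exp.div⟩
instance : Mod Exp := ⟨Exp.mod⟩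

/-- The value of an expression. For a positive divisor, `/` and `%` on `ℤ` are the floor of the
quotient and the remainder in `{0, …, divisor - 1}`. -/
def Exp.eval (σ : Store) : Exp → ℤ
  | .lit z => z
  | .reg x => σ x
  | .add e f => e.eval σ + f.eval σ
  | .sub e f => e.eval σ - f.eval σ
  | .mul e f => e.eval σ * f.eval σ
  | .div e f => e.eval σ / f.eval σ
  | .mod e f => e.eval σ % f.eval σ

/-- The number of arithmetic operations in an expression. -/
def Exp.cost : Exp → ℕ
  | .lit _ => 0
  | .reg _ => 0
  | .add e f => e.cost + f.cost + 1
  | .sub e f => e.cost + f.cost + 1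
  | .mul e f => e.cost + f.cost + 1
  | .div e f => e.cost + f.cost + 1
  | .mod e f => e.cost + f.cost + 1

/-- Tests. -/
inductive Test
  | lt (e f : Exp)
  | le (e f : Exp)
  | eq (e f : Exp)
  | and (p r : Test)

/-- The truth value of a test. -/
def Test.holds (σ : Store) : Test → Prop
  | .lt e f => e.eval σ < f.eval σ
  | .le e f => e.eval σ ≤ f.eval σ
  | .eq e f => e.eval σ = f.eval σ
  | .and p r => p.holds σ ∧ r.holds σ

/-- The number of steps of a test. -/
def Test.cost : Test → ℕ
  | .lt e f => e.cost + f.cost + 1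
  | .le e f => e.cost + f.cost + 1
  | .eq e f => e.cost + f.cost + 1
  | .and p r => p.cost + r.cost + 1

/-- Programs. -/
inductive Cmd
  | skip
  | assign (x : Reg) (e : Exp)
  | seq (p r : Cmd)
  | ite (t : Test) (p r : Cmd)
  | loop (t : Test) (p : Cmd)

infix:60 " ≔ " => Cmd.assign

/-- Sequential composition of a list of programs. -/
def block : List Cmd → Cmd
  | [] => .skip
  | p :: ps => .seq p (block ps)

/-- `Exec p σ τ n`: started in the store `σ`, the program `p` halts after exactly `n` steps, in the
store `τ`. -/
inductive Exec : Cmd → Store → Store → ℕ → Prop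
  | skip (σ : Store) : Exec .skip σ σ 0
  | assign (x : Reg) (e : Exp) (σ : Store) :
      Exec (x ≔ e) σ (Function.update σ x (e.eval σ)) (e.cost + 1)
  | seq {p r : Cmd} {σ τ υ : Store} {n₁ n₂ : ℕ} :
      Exec p σ τ n₁ → Exec r τ υ n₂ → Exec (.seq p r) σ υ (n₁ + n₂)
  | ite_true {t : Test} {p r : Cmd} {σ τ : Store} {n : ℕ} :
      t.holds σ → Exec p σ τ n → Exec (.ite t p r) σ τ (t.cost + n)
  | ite_false {t : Test} {p r : Cmd} {σ τ : Store} {n : ℕ} :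
      ¬ t.holds σ → Exec r σ τ n → Exec (.ite t p r) σ τ (t.cost + n)
  | loop_true {t : Test} {p : Cmd} {σ τ υ : Store} {n₁ n₂ : ℕ} :
      t.holds σ → Exec p σ τ n₁ → Exec (.loop t p) τ υ n₂ →
        Exec (.loop t p) σ υ (t.cost + n₁ + n₂)
  | loop_false {t : Test} {p : Cmd} {σ : Store} :
      ¬ t.holds σ → Exec (.loop t p) σ σ t.cost

/-! ## Discrete sums -/

open Reg Cmd Test in
/-- Extended Euclidean algorithm. Started with `r0, r1 ≥ 0`, it ends with the greatest common
divisor in `r0` and the Bézout coefficient of the first argument in `s0`. -/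
def euclid : Cmd :=
  block [
    s0 ≔ 1, s1 ≔ 0,
    loop (lt 0 r1) (block [
      quo ≔ r0 / r1,
      tmp ≔ r0 - quo * r1, r0 ≔ r1, r1 ≔ tmp,
      tmp ≔ s0 - quo * s1, s0 ≔ s1, s1 ≔ tmp])]

open Reg Cmd Test in
/-- Adds up, in `acc`, the numbers `j_i + off` below `top`, where `j_i = ⌊(o + i tt) / qh⌋`,
`0 ≤ i < qh`, is the increasing enumeration of the hS-type indices of one period. -/
def enumerate : Cmd :=
  block [
    acc ≔ 0, i ≔ 0, j ≔ o / qh + off,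
    loop (and (lt i qh) (lt j top)) (block [
      acc ≔ acc + j, i ≔ i + 1, j ≔ (o + i * tt) / qh + off])]

open Reg Cmd Test in
/-- The sum `corr` of all hS-type indices below `top`; these are `tt`-periodic, and
`j0 < ⋯ < jl` are those in `{0, …, tt - 1}`. -/
def hSCorrection : Cmd :=
  block [
    j0 ≔ o / qh, jl ≔ (o + (qh - 1) * tt) / qh, off ≔ 0,
    ite (le top j0) (corr ≔ 0) <|
    ite (le top jl) (block [enumerate, corr ≔ acc]) <|
    ite (le top (j0 + tt)) (block [enumerate, corr ≔ acc]) <|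
    block [
      u ≔ (top - 1) / tt,
      enumerate, accJ ≔ acc,
      off ≔ u * tt, enumerate,
      corr ≔ u * accJ + qh * tt * ((u - 1) * u / 2) + acc]]

open Reg Cmd Test in
/-- With `g = gcd(t, q)`: `tt = t / g`, and the remainders `qh`, `sh` of `q / g` and `⌊s / g⌋`
modulo `tt`. -/
def hSParameters : Cmd :=
  block [
    r0 ≔ t, r1 ≔ q, euclid,
    tt ≔ t / r0, qh ≔ q / r0 % tt, sh ≔ s / r0 % tt]

open Reg Cmd Test in
/-- Computes `S⁺(s, t, q, n) = ∑_{k=0}^{n} ⌊(s + k t) / q⌋` in `res`, for `0 ≤ s, t < q`. Here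
`top` is the greatest value of the summand, attained for the first time at `xtop`; an interval of
the summation index on which the summand is constant has `⌊q / t⌋` elements or, if it is of
hS-type, one more. -/
def sPlus : Cmd :=
  ite (eq t 0) (res ≔ 0) <|
  block [
    top ≔ (s + n * t) / q,
    xtop ≔ 0 - (s - top * q) / t,
    base ≔ q / t * (top * (top - 1) / 2) + top * (n - xtop + 1),
    ite (eq (q % t) 0) (res ≔ base) <|
    block [
      hSParameters,
      o ≔ sh,
      hSCorrection,
      res ≔ base + corr]]

open Reg Cmd Test in
/-- Computes `S⁻(s, t, q, n) = ∑_{k=0}^{n} ⌊(s - k t) / q⌋` in `res`, for `0 ≤ s, t < q`. Here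
`- top` is the least value of the summand, attained for the first time at `xtop + 1`. -/
def sMinus : Cmd :=
  ite (eq t 0) (res ≔ 0) <|
  block [
    top ≔ 0 - (s - n * t) / q,
    xtop ≔ (s + (top - 1) * q) / t,
    base ≔ 0 - q / t * (top * (top - 1) / 2) - top * (n - xtop),
    ite (eq (q % t) 0) (res ≔ base) <|
    block [
      hSParameters,
      ite (lt sh qh) (o ≔ qh - 1 - sh) (o ≔ tt + qh - 1 - sh),
      hSCorrection,
      res ≔ base - corr]]

/-! ## First phase: L-shape and basic factorization -/

open Reg Cmd Test in
/-- The vectors `(l, -y)` and `(ex, fx)` form a basis of the lattice of all `(s, t)` with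
`s a + t b ≡ 0` modulo `c`, and `(x0, y0)` has the label of `m`. Along the first `k` of the vectors
`(l, -y) - i (ex, fx)`, the point `(x0, y0)` is reduced; then `(l, -y)` is replaced by
`(l, -y) - k (ex, fx)`. -/
def advance : Cmd :=
  block [
    j1 ≔ (l - x0 + ex - 1) / ex,
    ite (lt j1 k) (block [x0 ≔ x0 - (l - j1 * ex), y0 ≔ y0 + (y + j1 * fx)]) skip,
    l ≔ l - k * ex, y ≔ y + k * fx,
    quo ≔ x0 / l, x0 ≔ x0 - quo * l, y0 ≔ y0 + quo * y]

open Reg Cmd Test in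
/-- Sets `jn` to the greatest `i` for which `(l, -y) - i (ex, fx)` has a non-negative value
`s a + t b`, and `jm` to the greatest `i` for which its first coordinate is non-negative. -/
def stepBounds : Cmd :=
  block [
    jn ≔ (l * a - y * b) / (ex * a + fx * b),
    jm ≔ l / ex]

open Reg Cmd Test in
/-- Computes an L-shape `L(l, h, w, y)` related to `⟨a, b, c⟩` and the basic factorization
`(x0, y0, z0)` of `m`. -/
def lShapePhase : Cmd :=
  block [
    r0 ≔ a, r1 ≔ c, euclid, gac ≔ r0, inv ≔ s0,
    l ≔ c / gac, y ≔ 0,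
    ex ≔ l - b * inv % l, fx ≔ gac,
    r0 ≔ b, r1 ≔ gac, euclid,
    y0 ≔ m * s0 % gac,
    x0 ≔ (m - y0 * b) / gac * inv % l,
    stepBounds,
    loop (le jm jn) (block [
      k ≔ jm, advance,
      quo ≔ (ex - 1) / l, ex ≔ ex - quo * l, fx ≔ fx + quo * y,
      stepBounds]),
    k ≔ jn, advance,
    w ≔ l - ex, h ≔ y + fx,
    z0 ≔ (m - x0 * a - y0 * b) / c]

/-! ## Second phase: the basic sum -/

open Reg Cmd Test in
/-- Computes in `part` one half of the basic sum, `∑_{k=0}^{am} S_k` for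
`(p0, side, width, dd, ee, gen) = (y0, h, y, δ, θ, a)` and `∑_{k=0}^{am} T_k` for
`(x0, l, w, θ, δ, b)`. The summand is `⌊(p0 + k side) / width⌋ - k` for `k < k1` and
`⌊(z0 - k ee) / dd⌋ - k` for `k ≥ k1`. -/
def halfSum : Cmd :=
  block [
    ite (eq dd 0) (k1 ≔ am + 1) <|
    ite (eq width 0) (k1 ≔ 0) <|
      k1 ≔ 0 - (p0 * dd - z0 * width) / gen,
    ite (eq k1 0)
      (block [
        s ≔ z0 % dd, t ≔ ee % dd, q ≔ dd, n ≔ am, sMinus,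
        part ≔ (1 + am) * (z0 / dd) - (ee / dd + 1) * (am * (1 + am) / 2) + res]) <|
    ite (le k1 am)
      (block [
        s ≔ p0 % width, t ≔ side % width, q ≔ width, n ≔ k1 - 1, sPlus,
        part ≔ (1 + am) * (z0 / dd) - (ee / dd + 1) * (am * (1 + am) / 2)
          + k1 * (p0 / width - z0 / dd)
          + (side / width + ee / dd) * ((k1 - 1) * k1 / 2) + res,
        alpha ≔ z0 % dd - k1 * (ee % dd),
        s ≔ alpha % dd, t ≔ ee % dd, q ≔ dd, n ≔ am - k1, sMinus,
        part ≔ part + alpha / dd * (1 + am - k1) + res]) <|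
    block [
      s ≔ p0 % width, t ≔ side % width, q ≔ width, n ≔ am, sPlus,
      part ≔ (1 + am) * (p0 / width) + (side / width - 1) * (am * (1 + am) / 2) + res]]

open Reg Cmd Test in
/-- Computes the denumerant of `m` in `out`, from an L-shape `L(l, h, w, y)` and the basic
factorization `(x0, y0, z0)`. A negative `z0` means that `m` is not in the semigroup. -/
def sumPhase : Cmd :=
  ite (lt z0 0) (out ≔ 0) <|
  block [
    delta ≔ (l * a - y * b) / c, theta ≔ (h * b - w * a) / c,
    am ≔ z0 / (delta + theta),
    p0 ≔ y0, side ≔ h, width ≔ y, dd ≔ delta, ee ≔ theta, gen ≔ a, halfSum, partY ≔ part,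
    p0 ≔ x0, side ≔ l, width ≔ w, dd ≔ theta, ee ≔ delta, gen ≔ b, halfSum,
    out ≔ 1 + am + partY + part]

/-- The complete algorithm, with input in the registers `a, b, c, m` and output in `out`. -/
def algorithm : Cmd :=
  block [lShapePhase, sumPhase]

end Denumerant

/-! The vectors of label `0` form a lattice of determinant `c` with basis `u = (l, -y)`, `v = (-w,
h)`, of values `δ c` and `θ c`. Every factorization of `m` arises from the basic one by adding `α u
+ β v` to the first two coordinates and subtracting `α δ + β θ` from the third. Because the square
lies in the L-shape, non-negativity of the first two coordinates forces `α, β ≥ 0`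
(`coords_nonneg`). Put `k = min α β` and `e = α - β`. For fixed `k` the admissible `e` fill the
interval from `-T_k` to `S_k`: if `e ≥ 0`, only the second and third coordinates can become
negative, and symmetrically for `e ≤ 0`. Counting the points of these intervals gives the basic sum
(`denumerant_eq_sum`).

Each summand is the smaller of two floors of linear functions of `k`. Solving the lattice equations
for the generators gives `a = h δ + y θ` and `b = w δ + l θ` (`generators_eq`); hence the bounds
cross at quotients by `a` and `b`, and `y, w, δ, θ ≤ b`. After integer parts are split off, at most
four sums `S^±(s, t, q, N)` with `q ≤ b` remain (`isHalfSummand_of_split`, `wp_halfSum`).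

Such a sum is evaluated through the places where the summand takes a new value
(`sum_eq_sum_thresholds`, `sum_thresholds_eq`). Consecutive places differ by `⌊q / t⌋` plus a
correction, and the correction at `j` counts the indices `⌊(o + i tt) / qh⌋` equal to `j`
(`floor_sub_eq_count`, `floor_add_eq_count`, `sum_hsIndex_eq`). These indices are `tt`-periodic with
`qh < tt ≤ t` of them per period, so enumerating a period twice suffices and the time is linear in
`t`, whatever `N` is.

For the L-shape, a basis `(l, -y)`, `(ex, fx)` is reduced as in Euclid's algorithm, together with a
point kept inside the L-shape belonging to the current basis (`Reduced.advance`). Each round at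
least halves `l`. When the next full step would make the value of `(l, -y)` negative, a partial step
yields a basis with both values non-negative, and such an L-shape is related to the semigroup
(`isRelatedLShape_of_le`).

Correctness and running time are proved together, by weakest preconditions whose postconditions
mention the number of steps. -/

namespace Denumerant

/-! ## Weakest preconditions for the machine model -/

/-- Started in `σ`, the program `p` halts, and its final store and number of steps satisfy `Q`. -/
def WP (p : Cmd) (σ : Store) (Q : Store → ℕ → Prop) : Prop :=
  ∃ τ n, Exec p σ τ n ∧ Q τ n

/-- The registers that a program may assign to. -/
def Cmd.writes : Cmd → Reg → Bool
  | .skip, _ => false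
  | .assign x _, z => decide (x = z)
  | .seq p r, z => p.writes z || r.writes z
  | .ite _ p r, z => p.writes z || r.writes z
  | .loop _ p, z => p.writes z

/-- Since `writes` is computed from the syntax, its side condition is closed by `rfl` for concrete
programs; register contents are carried past a subprogram in this way. -/
theorem Exec.frame {p : Cmd} {σ τ : Store} {n : ℕ} (h : Exec p σ τ n) :
    ∀ x, p.writes x = false → τ x = σ x := by
  induction h with
  | skip => intros; rfl
  | assign x e σ =>
    intro z hz
    have : x ≠ z := by simpa [Cmd.writes] using hz
    exact Function.update_of_ne this.symm _ _
  | seq _ _ ih₁ ih₂ =>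
    intro z hz
    simp only [Cmd.writes, Bool.or_eq_false_iff] at hz
    rw [ih₂ z hz.2, ih₁ z hz.1]
  | ite_true _ _ ih =>
    intro z hz
    simp only [Cmd.writes, Bool.or_eq_false_iff] at hz
    exact ih z hz.1
  | ite_false _ _ ih =>
    intro z hz
    simp only [Cmd.writes, Bool.or_eq_false_iff] at hz
    exact ih z hz.2
  | loop_true _ _ _ ih₁ ih₂ =>
    intro z hz
    rw [ih₂ z hz, ih₁ z hz]
  | loop_false => intros; rfl

/-- The rule by which specifications are composed: a postcondition lists only the registers that
change in a relevant way, and the frame supplies the others. -/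
theorem WP.call {p : Cmd} {σ : Store} {R Q : Store → ℕ → Prop} (h : WP p σ R)
    (hQ : ∀ τ n, R τ n → (∀ x, p.writes x = false → τ x = σ x) → Q τ n) : WP p σ Q := by
  obtain ⟨τ, n, he, hr⟩ := h
  exact ⟨τ, n, he, hQ τ n hr he.frame⟩

theorem wp_skip (σ : Store) (Q : Store → ℕ → Prop) : WP .skip σ Q ↔ Q σ 0 := by
  constructor
  · rintro ⟨τ, n, h, hq⟩
    cases h
    exact hq
  · exact fun h => ⟨_, _, .skip σ, h⟩

theorem wp_assign (x : Reg) (e : Exp) (σ : Store) (Q : Store → ℕ → Prop) :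
    WP (x ≔ e) σ Q ↔ Q (Function.update σ x (e.eval σ)) (e.cost + 1) := by
  constructor
  · rintro ⟨τ, n, h, hq⟩
    cases h
    exact hq
  · exact fun h => ⟨_, _, .assign x e σ, h⟩

theorem wp_seq (p r : Cmd) (σ : Store) (Q : Store → ℕ → Prop) :
    WP (.seq p r) σ Q ↔ WP p σ fun τ n => WP r τ fun υ k => Q υ (n + k) := by
  constructor
  · rintro ⟨τ, n, h, hq⟩
    cases h with
    | seq h₁ h₂ => exact ⟨_, _, h₁, _, _, h₂, hq⟩
  · rintro ⟨τ, n, h₁, υ, k, h₂, hq⟩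
    exact ⟨_, _, .seq h₁ h₂, hq⟩

theorem wp_ite (t : Test) (p r : Cmd) (σ : Store) (Q : Store → ℕ → Prop) :
    WP (.ite t p r) σ Q ↔
      (t.holds σ → WP p σ fun τ n => Q τ (t.cost + n)) ∧
      (¬ t.holds σ → WP r σ fun τ n => Q τ (t.cost + n)) := by
  constructor
  · rintro ⟨τ, n, h, hq⟩
    cases h with
    | ite_true ht h => exact ⟨fun _ => ⟨_, _, h, hq⟩, fun hn => absurd ht hn⟩
    | ite_false ht h => exact ⟨fun hn => absurd hn ht, fun _ => ⟨_, _, h, hq⟩⟩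
  · rintro ⟨h₁, h₂⟩
    by_cases ht : t.holds σ
    · obtain ⟨τ, n, h, hq⟩ := h₁ ht
      exact ⟨_, _, .ite_true ht h, hq⟩
    · obtain ⟨τ, n, h, hq⟩ := h₂ ht
      exact ⟨_, _, .ite_false ht h, hq⟩

theorem wp_block_nil (σ : Store) (Q : Store → ℕ → Prop) : WP (block []) σ Q ↔ Q σ 0 :=
  wp_skip σ Q

theorem wp_block_cons (p : Cmd) (ps : List Cmd) (σ : Store) (Q : Store → ℕ → Prop) :
    WP (block (p :: ps)) σ Q ↔ WP p σ fun τ n => WP (block ps) τ fun υ k => Q υ (n + k) :=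
  wp_seq p (block ps) σ Q

theorem WP.split (n : ℕ) {L : List Cmd} {σ : Store} {Q : Store → ℕ → Prop}
    (h : WP (block (L.take n)) σ fun τ k => WP (block (L.drop n)) τ fun υ k' => Q υ (k + k')) :
    WP (block L) σ Q := by
  induction n generalizing L σ Q with
  | zero => simpa [wp_block_nil] using h
  | succ n ih =>
    cases L with
    | nil => simpa [wp_block_nil] using h
    | cons p L =>
      simp only [List.take_succ_cons, List.drop_succ_cons, wp_block_cons] at h ⊢
      refine h.call fun τ k h' _ => ih ?_
      simpa only [add_assoc] using h'

/-- If `I k σ` guarantees that at most `k` iterations remain, and each iteration takes at most `d`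
steps, then the loop halts within `k (cost + d) + cost` steps. -/
theorem wp_loop {t : Test} {p : Cmd} (I : ℕ → Store → Prop) (d : ℕ)
    (hstep : ∀ k σ, I k σ → t.holds σ →
      ∃ k', k = k' + 1 ∧ WP p σ fun τ n => I k' τ ∧ n ≤ d) :
    ∀ k σ, I k σ → WP (.loop t p) σ fun τ n =>
      (∃ k', I k' τ) ∧ ¬ t.holds τ ∧ n ≤ k * (t.cost + d) + t.cost := by
  intro k
  induction k with
  | zero =>
    intro σ hσ
    by_cases ht : t.holds σ
    · obtain ⟨k', hk, _⟩ := hstep 0 σ hσ ht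
      omega
    · exact ⟨_, _, .loop_false ht, ⟨0, hσ⟩, ht, by omega⟩
  | succ k ih =>
    intro σ hσ
    by_cases ht : t.holds σ
    · obtain ⟨k', hk, τ, n, he, hi, hn⟩ := hstep _ σ hσ ht
      obtain rfl : k = k' := by omega
      obtain ⟨υ, n', he', hi', ht', hn'⟩ := ih τ hi
      refine ⟨υ, _, .loop_true ht he he', hi', ht', ?_⟩
      have : (k + 1) * (t.cost + d) = k * (t.cost + d) + (t.cost + d) := by ring
      omega
    · exact ⟨_, _, .loop_false ht, ⟨_, hσ⟩, ht, by omega⟩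

/-! ### Symbolic execution of straight-line code by `simp` -/

section Eval

variable (σ : Store) (e f : Exp)

theorem Exp.eval_reg (x : Reg) : (Exp.reg x).eval σ = σ x := rfl
theorem Exp.eval_zero : (0 : Exp).eval σ = 0 := rfl
theorem Exp.eval_one : (1 : Exp).eval σ = 1 := rfl
theorem Exp.eval_two : (2 : Exp).eval σ = 2 := rfl
theorem Exp.eval_add : (e + f).eval σ = e.eval σ + f.eval σ := rfl
theorem Exp.eval_sub : (e - f).eval σ = e.eval σ - f.eval σ := rfl
theorem Exp.eval_mul : (e * f).eval σ = e.eval σ * f.eval σ := rfl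
theorem Exp.eval_div : (e / f).eval σ = e.eval σ / f.eval σ := rfl
theorem Exp.eval_mod : (e % f).eval σ = e.eval σ % f.eval σ := rfl
theorem Exp.cost_reg (x : Reg) : (Exp.reg x).cost = 0 := rfl
theorem Exp.cost_zero : (0 : Exp).cost = 0 := rfl
theorem Exp.cost_one : (1 : Exp).cost = 0 := rfl
theorem Exp.cost_two : (2 : Exp).cost = 0 := rfl
theorem Exp.cost_add : (e + f).cost = e.cost + f.cost + 1 := rfl
theorem Exp.cost_sub : (e - f).cost = e.cost + f.cost + 1 := rfl
theorem Exp.cost_mul : (e * f).cost = e.cost + f.cost + 1 := rfl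
theorem Exp.cost_div : (e / f).cost = e.cost + f.cost + 1 := rfl
theorem Exp.cost_mod : (e % f).cost = e.cost + f.cost + 1 := rfl

end Eval

attribute [simp] wp_skip wp_assign wp_seq wp_ite wp_block_nil wp_block_cons Test.holds Test.cost
  Exp.eval_reg Exp.eval_zero Exp.eval_one Exp.eval_two Exp.eval_add Exp.eval_sub Exp.eval_mul
  Exp.eval_div Exp.eval_mod
  Exp.cost_reg Exp.cost_zero Exp.cost_one Exp.cost_two Exp.cost_add Exp.cost_sub Exp.cost_mul
  Exp.cost_div Exp.cost_mod Function.update_apply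

/-! ## The Euclidean algorithm -/

/-- The loop of `euclid`, with at most `k` iterations by any measure of termination. -/
theorem wp_euclid_loop (A B : ℤ) (J : ℕ → ℤ → ℤ → Prop)
    (hJ : ∀ k r₀ r₁, J k r₀ r₁ → 0 ≤ r₀ → 0 < r₁ → ∃ k', k = k' + 1 ∧ J k' r₁ (r₀ % r₁))
    (k : ℕ) (σ : Store) (hk : J k (σ .r0) (σ .r1)) (h₀ : 0 ≤ σ .r0) (h₁ : 0 ≤ σ .r1)
    (hg : Int.gcd (σ .r0) (σ .r1) = Int.gcd A B) (hs₀ : B ∣ σ .s0 * A - σ .r0)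
    (hs₁ : B ∣ σ .s1 * A - σ .r1) :
    WP (.loop (.lt 0 Reg.r1) (block [
      .quo ≔ Reg.r0 / Reg.r1,
      .tmp ≔ Reg.r0 - Reg.quo * Reg.r1, .r0 ≔ Reg.r1, .r1 ≔ Reg.tmp,
      .tmp ≔ Reg.s0 - Reg.quo * Reg.s1, .s0 ≔ Reg.s1, .s1 ≔ Reg.tmp])) σ fun τ n =>
      τ .r0 = Int.gcd A B ∧ B ∣ τ .s0 * A - τ .r0 ∧ n ≤ 13 * k + 1 := by
  have key := wp_loop (t := .lt 0 Reg.r1) (p := block [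
      .quo ≔ Reg.r0 / Reg.r1,
      .tmp ≔ Reg.r0 - Reg.quo * Reg.r1, .r0 ≔ Reg.r1, .r1 ≔ Reg.tmp,
      .tmp ≔ Reg.s0 - Reg.quo * Reg.s1, .s0 ≔ Reg.s1, .s1 ≔ Reg.tmp])
    (fun k σ => J k (σ .r0) (σ .r1) ∧ 0 ≤ σ .r0 ∧ 0 ≤ σ .r1 ∧
      Int.gcd (σ .r0) (σ .r1) = Int.gcd A B ∧ B ∣ σ .s0 * A - σ .r0 ∧ B ∣ σ .s1 * A - σ .r1) 12
    (by
      rintro k σ ⟨hk, h₀, h₁, hg, hs₀, hs₁⟩ ht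
      simp only [Test.holds, Exp.eval_zero, Exp.eval_reg] at ht
      obtain ⟨k', rfl, hk'⟩ := hJ k _ _ hk h₀ ht
      refine ⟨k', rfl, ?_⟩
      have hmod : σ .r0 - σ .r0 / σ .r1 * σ .r1 = σ .r0 % σ .r1 := by
        rw [Int.emod_def, mul_comm]
      refine WP.call (R := fun τ n => τ .r0 = σ .r1 ∧ τ .r1 = σ .r0 - σ .r0 / σ .r1 * σ .r1 ∧
        τ .s0 = σ .s1 ∧ τ .s1 = σ .s0 - σ .r0 / σ .r1 * σ .s1 ∧ n = 12) (by simp) ?_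
      rintro τ n ⟨e₁, e₂, e₃, e₄, rfl⟩ -
      rw [e₁, e₂, e₃, e₄, hmod]
      refine ⟨⟨hk', h₁, Int.emod_nonneg _ ht.ne',
        by rw [← hg, Int.gcd_comm, Int.gcd_emod], hs₁, ?_⟩, le_rfl⟩
      rw [← hmod]
      have : (σ .s0 - σ .r0 / σ .r1 * σ .s1) * A - (σ .r0 - σ .r0 / σ .r1 * σ .r1) =
        (σ .s0 * A - σ .r0) - σ .r0 / σ .r1 * (σ .s1 * A - σ .r1) := by ring
      rw [this]
      exact dvd_sub hs₀ (hs₁.mul_left _))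
    k σ ⟨hk, h₀, h₁, hg, hs₀, hs₁⟩
  refine key.call ?_
  rintro τ n ⟨⟨k', _, h₀, h₁, hg, hs₀, hs₁⟩, ht, hn⟩ -
  simp at ht hn
  have hr : τ .r1 = 0 := le_antisymm ht h₁
  rw [hr, Int.gcd_zero_right] at hg
  refine ⟨by omega, hs₀, by omega⟩

/-- The termination measure `J` is left open because two bounds are needed: one linear in the
smaller argument, for the discrete sums, and a logarithmic one, for the first phase. -/
theorem wp_euclid (J : ℕ → ℤ → ℤ → Prop)
    (hJ : ∀ k r₀ r₁, J k r₀ r₁ → 0 ≤ r₀ → 0 < r₁ → ∃ k', k = k' + 1 ∧ J k' r₁ (r₀ % r₁))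
    (k : ℕ) (σ : Store) (hk : J k (σ .r0) (σ .r1)) (h₀ : 0 ≤ σ .r0) (h₁ : 0 ≤ σ .r1) :
    WP euclid σ fun τ n =>
      τ .r0 = Int.gcd (σ .r0) (σ .r1) ∧ σ .r1 ∣ τ .s0 * σ .r0 - τ .r0 ∧ n ≤ 13 * k + 3 := by
  unfold euclid
  simp only [wp_block_cons, wp_assign, wp_block_nil, Exp.eval_one, Exp.eval_zero, Exp.cost_one,
    Exp.cost_zero]
  refine (wp_euclid_loop (σ .r0) (σ .r1) J hJ k _ ?_ ?_ ?_ ?_ ?_ ?_).call ?_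
  all_goals simp [hk, h₀, h₁]
  intro τ n h₁ h₂ h₃ _
  exact ⟨h₁, h₂, by omega⟩

/-- The running time of the Euclidean algorithm is linear in the smaller argument. -/
theorem wp_euclid_linear (k : ℕ) (σ : Store) (h₀ : 0 ≤ σ .r0) (h₁ : 0 ≤ σ .r1)
    (hk : σ .r0 ≤ k) (hlt : σ .r0 < σ .r1) :
    WP euclid σ fun τ n =>
      τ .r0 = Int.gcd (σ .r0) (σ .r1) ∧ σ .r1 ∣ τ .s0 * σ .r0 - τ .r0 ∧ n ≤ 13 * k + 16 := by
  -- The second argument decreases strictly. If it is the larger one at the start, the first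
  -- iteration merely swaps the arguments; this accounts for the `1` in `r₀ + 1 ≤ k`.
  refine (wp_euclid (fun k r₀ r₁ => r₁ ≤ k ∨ r₀ < r₁ ∧ r₀ + 1 ≤ k) ?_ (k + 1) σ ?_ h₀ h₁).call ?_
  · rintro k r₀ r₁ h hr₀ hr₁
    have := Int.emod_lt_of_pos r₀ hr₁
    refine ⟨k - 1, by omega, ?_⟩
    rcases h with h | ⟨h, h'⟩
    · left; omega
    · left; rw [Int.emod_eq_of_lt hr₀ h]; omega
  · right; push_cast; omega
  · rintro τ n ⟨h₁, h₂, h₃⟩ -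
    exact ⟨h₁, h₂, by omega⟩

/-- The running time of the Euclidean algorithm is logarithmic. -/
theorem wp_euclid_log (k : ℕ) (σ : Store) (h₀ : 0 ≤ σ .r0) (h₁ : 0 ≤ σ .r1)
    (hk : σ .r0 * σ .r1 < 2 ^ k) :
    WP euclid σ fun τ n =>
      τ .r0 = Int.gcd (σ .r0) (σ .r1) ∧ σ .r1 ∣ τ .s0 * σ .r0 - τ .r0 ∧ n ≤ 13 * k + 29 := by
  -- Once `r₁ ≤ r₀`, the remainder is at most half of `r₀`, so the product of the two arguments is
  -- at least halved. A possible initial swap costs one more iteration.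
  refine (wp_euclid (fun k r₀ r₁ => 0 ≤ r₁ ∧ (r₁ = 0 ∨ r₁ ≤ r₀ ∧ r₀ * r₁ < 2 ^ k ∨ r₀ < r₁ ∧
      ∃ k', k = k' + 1 ∧ r₀ * r₁ < 2 ^ k')) ?_ (k + 2) σ ?_ h₀ h₁).call ?_
  · rintro k r₀ r₁ ⟨-, h⟩ hr₀ hr₁
    have h1 := Int.emod_lt_of_pos r₀ hr₁
    have h2 := Int.emod_nonneg r₀ hr₁.ne'
    rcases h with h | ⟨h, h'⟩ | ⟨h, k', rfl, h'⟩
    · omega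
    · obtain ⟨k', rfl⟩ : ∃ k', k = k' + 1 := by
        refine ⟨k - 1, ?_⟩
        rcases k with _ | k
        · nlinarith
        · rfl
      refine ⟨k', rfl, h2, .inr (.inl ⟨h1.le, ?_⟩)⟩
      have h3 : 2 * (r₀ % r₁) ≤ r₀ := by
        have := Int.emod_add_mul_ediv r₀ r₁
        have : 1 ≤ r₀ / r₁ := by rwa [Int.le_ediv_iff_mul_le hr₁, one_mul]
        nlinarith
      rw [pow_succ] at h'
      nlinarith
    · refine ⟨k', rfl, h2, ?_⟩
      rw [Int.emod_eq_of_lt hr₀ h]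
      exact .inr (.inl ⟨h.le, by linarith [mul_comm r₀ r₁]⟩)
  · refine ⟨h₁, ?_⟩
    rcases lt_or_ge (σ .r0) (σ .r1) with h | h
    · refine .inr (.inr ⟨h, k + 1, rfl, hk.trans ?_⟩)
      exact pow_lt_pow_right₀ (by norm_num) (by omega)
    · refine .inr (.inl ⟨h, hk.trans ?_⟩)
      exact pow_lt_pow_right₀ (by norm_num) (by omega)
  · rintro τ n ⟨h₁, h₂, h₃⟩ -
    exact ⟨h₁, h₂, by omega⟩

/-! ## Integer division -/

theorem ediv_eq_of_bounds {x t z : ℤ} (h₁ : t * z ≤ x) (h₂ : x < t * z + t) : x / t = z := by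
  have ht : 0 < t := by linarith
  apply le_antisymm
  · rw [← Int.lt_add_one_iff, Int.ediv_lt_iff_lt_mul ht]
    linarith
  · rw [Int.le_ediv_iff_mul_le ht]
    linarith

theorem neg_ediv_of_pos (x : ℤ) {t : ℤ} (ht : 0 < t) : -x / t = -((x - 1) / t) - 1 := by
  have h₁ := Int.mul_ediv_self_le (x := x - 1) ht.ne'
  have h₂ := Int.lt_mul_ediv_self_add (x := x - 1) ht
  apply ediv_eq_of_bounds <;> linarith

/-- Ceilings are written as `-(-x / t)`; this is their Galois connection. -/
theorem le_neg_ediv_neg_iff {x t k : ℤ} (ht : 0 < t) : -(-x / t) ≤ k ↔ x ≤ t * k := by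
  rw [neg_le, Int.le_ediv_iff_mul_le ht]
  constructor <;> intro h <;> linarith

theorem triangle_succ (M : ℤ) : (M + 1) * M / 2 = M * (M - 1) / 2 + M := by
  rw [show (M + 1) * M = M * (M - 1) + M * 2 by ring, Int.add_mul_ediv_right _ _ two_ne_zero]

/-- Reduction of a floor to coprime parameters and to remainders. -/
theorem ediv_reduce (s q' j : ℤ) {g tt : ℤ} (hg : 0 < g) (ht : 0 < tt) :
    (s + j * (g * q')) / (g * tt) =
      (s / g % tt + j * (q' % tt)) / tt + s / g / tt + j * (q' / tt) := by
  rw [← Int.ediv_ediv_of_nonneg hg.le, show s + j * (g * q') = s + g * (j * q') by ring,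
    Int.add_mul_ediv_left _ _ hg.ne']
  conv_lhs => rw [← Int.emod_add_mul_ediv (s / g) tt, ← Int.emod_add_mul_ediv q' tt]
  rw [show s / g % tt + tt * (s / g / tt) + j * (q' % tt + tt * (q' / tt)) =
    s / g % tt + j * (q' % tt) + tt * (s / g / tt + j * (q' / tt)) by ring,
    Int.add_mul_ediv_left _ _ ht.ne']
  ring

/-! ## Sums of step functions -/

theorem sum_range_ite_le (K : ℕ) (e : ℤ) (h₀ : 0 ≤ e) (hK : e ≤ K) :
    ∑ i ∈ Finset.range K, (if (i : ℤ) < e then (1 : ℤ) else 0) = e := by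
  lift e to ℕ using h₀
  have hK' : e ≤ K := by exact_mod_cast hK
  rw [Finset.sum_ite, Finset.sum_const_zero, add_zero, Finset.sum_const, nsmul_one]
  congr 1
  rw [show (Finset.range K).filter (fun i : ℕ => (i : ℤ) < e) = Finset.range e by
    ext i; simp only [Finset.mem_filter, Finset.mem_range]; omega]
  exact Finset.card_range e

/-- Double counting of the pairs `(k, j)` with `1 ≤ j ≤ f k`: for fixed `j` they are the `k` from
the threshold `x j` up to `N`. -/
theorem sum_eq_sum_thresholds (N M : ℕ) (f : ℕ → ℤ) (x : ℕ → ℤ)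
    (hf₀ : ∀ k ≤ N, 0 ≤ f k) (hfM : ∀ k ≤ N, f k ≤ M)
    (hx : ∀ j, 1 ≤ j → j ≤ M → ∀ k ≤ N, ((j : ℤ) ≤ f k ↔ x j ≤ k))
    (hx₀ : ∀ j, 1 ≤ j → j ≤ M → 0 ≤ x j ∧ x j ≤ N + 1) :
    ∑ k ∈ Finset.range (N + 1), f k = ∑ j ∈ Finset.range M, ((N : ℤ) + 1 - x (j + 1)) := by
  have h₁ : ∀ k ∈ Finset.range (N + 1),
      f k = ∑ j ∈ Finset.range M, (if (j : ℤ) < f k then (1 : ℤ) else 0) := by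
    intro k hk
    have hk' : k ≤ N := by simpa [Nat.lt_succ_iff] using hk
    rw [sum_range_ite_le _ _ (hf₀ k hk') (hfM k hk')]
  rw [Finset.sum_congr rfl h₁, Finset.sum_comm]
  refine Finset.sum_congr rfl fun j hj => ?_
  have hj' : j + 1 ≤ M := by simpa using hj
  obtain ⟨h₂, h₃⟩ := hx₀ (j + 1) (by omega) hj'
  have h₄ := sum_range_ite_le (N + 1) (x (j + 1)) h₂ (by push_cast; exact h₃)
  have h₅ : ∑ k ∈ Finset.range (N + 1), (if (j : ℤ) < f k then (1 : ℤ) else 0) =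
      ∑ k ∈ Finset.range (N + 1), ((1 : ℤ) - if (k : ℤ) < x (j + 1) then (1 : ℤ) else 0) := by
    refine Finset.sum_congr rfl fun k hk => ?_
    have hk' : k ≤ N := by simpa [Nat.lt_succ_iff] using hk
    have := hx (j + 1) (by omega) hj' k hk'
    push_cast at this
    split_ifs <;> omega
  rw [h₅, Finset.sum_sub_distrib, h₄]
  simp

/-- Summation by parts: the value `j < M` is held on a stretch of length `Q + ε j` and contributes
`j` times that length; the value `M` is held from `x M` to the end. -/
theorem sum_thresholds_eq (A Q : ℤ) (x ε : ℕ → ℤ) (M : ℕ)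
    (hx : ∀ j, 1 ≤ j → j < M → x (j + 1) = x j + Q + ε j) :
    ∑ j ∈ Finset.range M, (A - x (j + 1)) =
      Q * ((M : ℤ) * (M - 1) / 2) + M * (A - x M) + ∑ j ∈ Finset.range M, (j : ℤ) * ε j := by
  induction M with
  | zero => simp
  | succ M ih =>
    rw [Finset.sum_range_succ, ih fun j h₁ h₂ => hx j h₁ (by omega), Finset.sum_range_succ]
    push_cast
    rw [add_sub_cancel_right, triangle_succ]
    rcases Nat.eq_zero_or_pos M with rfl | h
    · simp
    · rw [hx M h (by omega)]
      ring

/-! ## Enumeration of the indices of hS-type -/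

/-- The `i`-th index of hS-type. -/
def hsIndex (o tt qh : ℤ) (i : ℕ) : ℤ := (o + i * tt) / qh

section HsIndex

variable {o tt qh : ℤ}

theorem hsIndex_mono (ht : 0 ≤ tt) (hq : 0 < qh) : Monotone (hsIndex o tt qh) := by
  intro i j h
  apply Int.ediv_le_ediv hq
  have : (i : ℤ) ≤ j := by exact_mod_cast h
  nlinarith

theorem hsIndex_add_mul (hq : 0 < qh) (Q : ℕ) (hQ : qh = Q) (i v : ℕ) :
    hsIndex o tt qh (Q * v + i) = hsIndex o tt qh i + v * tt := by
  unfold hsIndex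
  push_cast
  rw [← hQ, show o + (qh * v + i) * tt = o + i * tt + qh * (v * tt) by ring,
    Int.add_mul_ediv_left _ _ hq.ne']

/-- Inverts the enumeration: the right-hand side is the counting function of the indices below `j`.
-/
theorem hsIndex_lt_iff (ht : 0 < tt) (hq : 0 < qh) (i : ℕ) (j : ℤ) :
    hsIndex o tt qh i < j ↔ (i : ℤ) < (j * qh - o - 1) / tt + 1 := by
  unfold hsIndex
  rw [Int.ediv_lt_iff_lt_mul hq, Int.lt_add_one_iff, Int.le_ediv_iff_mul_le ht]
  constructor <;> intro h <;> linarith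

/-- The sum of the hS-type indices below `M`, in terms of their counting function. -/
theorem sum_hsIndex_eq (ho : 0 ≤ o) (hot : o < tt) (hq : 0 < qh) (M K : ℕ)
    (hK : ∀ i ≥ K, (M : ℤ) ≤ hsIndex o tt qh i) :
    ∑ i ∈ Finset.range K, (if hsIndex o tt qh i < M then hsIndex o tt qh i else 0) =
      ∑ j ∈ Finset.range M,
        (j : ℤ) * ((((j + 1 : ℕ) : ℤ) * qh - o - 1) / tt - ((j : ℤ) * qh - o - 1) / tt) := by
  have ht : 0 < tt := by linarith
  induction M with
  | zero =>
    refine Finset.sum_eq_zero fun i _ => if_neg ?_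
    have : (0 : ℤ) ≤ hsIndex o tt qh i := Int.ediv_nonneg (by positivity) hq.le
    simpa using this
  | succ M ih =>
    -- The coefficient of `j` is a difference of two consecutive values of this counting function,
    -- hence the number of `i` whose index equals `j`.
    have hcount : ∀ j : ℕ, j ≤ M + 1 →
        ∑ i ∈ Finset.range K, (if hsIndex o tt qh i < j then (1 : ℤ) else 0) =
          ((j : ℤ) * qh - o - 1) / tt + 1 := by
      intro j hj
      simp only [hsIndex_lt_iff ht hq]
      apply sum_range_ite_le
      · have : -1 ≤ ((j : ℤ) * qh - o - 1) / tt := by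
          rw [Int.le_ediv_iff_mul_le ht]
          have : 0 ≤ (j : ℤ) * qh := by positivity
          linarith
        linarith
      · by_contra hlt
        have h₁ : hsIndex o tt qh K < j := (hsIndex_lt_iff ht hq K j).2 (not_le.1 hlt)
        have h₂ := hK K le_rfl
        push_cast at h₂
        omega
    rw [Finset.sum_range_succ, ← ih fun i hi => by have := hK i hi; push_cast at this; omega]
    have e₁ := hcount M (by omega)
    have e₂ := hcount (M + 1) le_rfl
    rw [show (((M + 1 : ℕ) : ℤ) * qh - o - 1) / tt - ((M : ℤ) * qh - o - 1) / tt =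
      ((((M + 1 : ℕ) : ℤ) * qh - o - 1) / tt + 1) - (((M : ℤ) * qh - o - 1) / tt + 1) by ring,
      ← e₁, ← e₂, ← Finset.sum_sub_distrib, Finset.mul_sum, ← Finset.sum_add_distrib]
    refine Finset.sum_congr rfl fun i _ => ?_
    push_cast
    split_ifs with h₁ h₂ h₂ <;> omega

end HsIndex

theorem wp_enumerate (σ : Store) (Q : ℕ) (hQ : σ .qh = Q) (hq : 0 < σ .qh) (ht : 0 ≤ σ .tt) :
    WP enumerate σ fun τ n =>
      τ .acc = ∑ i ∈ Finset.range Q,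
        (if hsIndex (σ .o) (σ .tt) (σ .qh) i + σ .off < σ .top then
          hsIndex (σ .o) (σ .tt) (σ .qh) i + σ .off else 0) ∧
      n ≤ 13 * Q + 8 := by
  set J := hsIndex (σ .o) (σ .tt) (σ .qh) with hJ
  unfold enumerate
  simp only [wp_block_cons, wp_block_nil]
  refine WP.call (R := fun τ n => τ .acc = 0 ∧ n = 1) (by simp) ?_
  rintro τ₁ _ ⟨e₁, rfl⟩ f₁
  refine WP.call (R := fun τ n => τ .i = 0 ∧ n = 1) (by simp) ?_
  rintro τ₂ _ ⟨e₂, rfl⟩ f₂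
  refine WP.call (R := fun τ n => τ .j = τ₂ .o / τ₂ .qh + τ₂ .off ∧ n = 3) (by simp) ?_
  rintro τ₃ _ ⟨e₃, rfl⟩ f₃
  have frame : ∀ x, x ≠ .acc → x ≠ .i → x ≠ .j → τ₃ x = σ x := by
    intro x h₁ h₂ h₃
    rw [f₃ x (by simpa [Cmd.writes] using h₃.symm), f₂ x (by simpa [Cmd.writes] using h₂.symm),
      f₁ x (by simpa [Cmd.writes] using h₁.symm)]
  -- The register `j` already holds the next index, which is not yet part of `acc`; on exit it may
  -- be the first index beyond the period or beyond `top`.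
  refine (wp_loop (fun k τ => ∃ i : ℕ, i + k = Q ∧ τ .i = i ∧ τ .j = J i + σ .off ∧
    τ .acc = ∑ i' ∈ Finset.range i, (J i' + σ .off) ∧ (∀ i' < i, J i' + σ .off < σ .top) ∧
    τ .o = σ .o ∧ τ .tt = σ .tt ∧ τ .qh = σ .qh ∧ τ .off = σ .off ∧ τ .top = σ .top) 9 ?_ Q τ₃
    ?_).call ?_
  · rintro k τ ⟨i, hi, a₁, a₂, a₃, a₄, b₁, b₂, b₃, b₄, b₅⟩ ht
    simp only [Test.holds, Exp.eval_reg, a₁, a₂, b₃, b₅] at ht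
    refine ⟨k - 1, by omega, WP.call (R := fun υ n => υ .i = τ .i + 1 ∧
      υ .acc = τ .acc + τ .j ∧
      υ .j = (τ .o + (τ .i + 1) * τ .tt) / τ .qh + τ .off ∧ n = 9) (by simp) ?_⟩
    rintro υ _ ⟨c₁, c₂, c₃, rfl⟩ f
    refine ⟨⟨i + 1, by omega, ?_, ?_, ?_, ?_, ?_⟩, le_rfl⟩
    · rw [c₁, a₁]; push_cast; rfl
    · rw [c₃, b₁, b₂, b₃, b₄, a₁, hJ]
      simp [hsIndex]
    · rw [c₂, a₃, a₂, Finset.sum_range_succ]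
    · intro i' hi'
      rcases Nat.lt_succ_iff_lt_or_eq.1 hi' with h | rfl
      · exact a₄ i' h
      · exact ht.2
    · rw [f .o rfl, f .tt rfl, f .qh rfl, f .off rfl, f .top rfl]
      exact ⟨b₁, b₂, b₃, b₄, b₅⟩
  · refine ⟨0, by omega, ?_, ?_, ?_, ?_, ?_⟩
    · rw [f₃ _ rfl, e₂]; rfl
    · rw [e₃, f₂ _ rfl, f₂ _ rfl, f₂ _ rfl, f₁ _ rfl, f₁ _ rfl, f₁ _ rfl, hJ]
      simp [hsIndex]
    · rw [f₃ _ rfl, f₂ _ rfl, e₁]; simp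
    · intro i' hi'; omega
    · refine ⟨?_, ?_, ?_, ?_, ?_⟩ <;> exact frame _ (by decide) (by decide) (by decide)
  · rintro τ n ⟨⟨k, i, hi, a₁, a₂, a₃, a₄, b₁, b₂, b₃, b₄, b₅⟩, ht', hn⟩ -
    simp only [Test.holds, Exp.eval_reg, a₁, a₂, b₃, b₅] at ht'
    simp only [Test.cost, Exp.cost_reg] at hn
    refine ⟨?_, by omega⟩
    rw [a₃, Finset.sum_ite, Finset.sum_const_zero, add_zero]
    congr 1
    ext i'
    simp only [Finset.mem_filter, Finset.mem_range]
    constructor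
    · exact fun h => ⟨by omega, a₄ i' h⟩
    · rintro ⟨h₁, h₂⟩
      -- The enumeration increases, so an exit caused by `top` misses no index below `top`.
      by_contra hcon
      have h₃ : J i ≤ J i' := hsIndex_mono ht hq (by omega)
      apply ht'
      constructor <;> omega

/-- The `v`-th period is the zeroth one shifted by `v tt`; the shifts of its `qh` members add up to
a triangular number. -/
theorem sum_hsIndex_period {o tt qh : ℤ} (hq : 0 < qh) (Q : ℕ) (hQ : qh = Q) (u : ℕ) :
    ∑ i ∈ Finset.range (Q * u), hsIndex o tt qh i =
      u * ∑ i ∈ Finset.range Q, hsIndex o tt qh i + qh * tt * (((u : ℤ) - 1) * u / 2) := by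
  induction u with
  | zero => simp
  | succ u ih =>
    rw [Nat.mul_succ, Finset.sum_range_add, ih]
    simp only [hsIndex_add_mul hq Q hQ, Finset.sum_add_distrib, Finset.sum_const,
      Finset.card_range, nsmul_eq_mul]
    push_cast
    rw [add_sub_cancel_right, mul_comm (u : ℤ) (u + 1), triangle_succ, ← hQ,
      mul_comm ((u : ℤ) - 1)]
    ring

theorem wp_hSCorrection (σ : Store) (Q M : ℕ) (hQ : σ .qh = Q) (hq : 0 < σ .qh)
    (ho : 0 ≤ σ .o) (hot : σ .o < σ .tt) (hM : σ .top = M) :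
    WP hSCorrection σ fun τ n =>
      τ .corr = ∑ j ∈ Finset.range M, (j : ℤ) *
        ((((j + 1 : ℕ) : ℤ) * σ .qh - σ .o - 1) / σ .tt - ((j : ℤ) * σ .qh - σ .o - 1) / σ .tt) ∧
      n ≤ 26 * Q + 50 := by
  have ht : 0 < σ .tt := by linarith
  set J := hsIndex (σ .o) (σ .tt) (σ .qh) with hJ
  have hmono : Monotone J := hsIndex_mono ht.le hq
  -- The cut-off `K` only has to leave out no index below `M`, so each branch may choose its own:
  -- `0`, `Q` or `Q * (u + 1)`.
  suffices h : WP hSCorrection σ fun τ n =>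
      (∃ K : ℕ, (∀ i ≥ K, (M : ℤ) ≤ J i) ∧
        τ .corr = ∑ i ∈ Finset.range K, (if J i < M then J i else 0)) ∧ n ≤ 26 * Q + 50 by
    refine h.call ?_
    rintro τ n ⟨⟨K, hK, e⟩, hn⟩ -
    exact ⟨by rw [e, sum_hsIndex_eq ho hot hq M K hK], hn⟩
  unfold hSCorrection
  refine WP.split 3 (WP.call (R := fun τ n => τ .j0 = σ .o / σ .qh ∧
    τ .jl = (σ .o + (σ .qh - 1) * σ .tt) / σ .qh ∧ τ .off = 0 ∧ n = 8) (by simp) ?_)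
  rintro τ n ⟨e₁, e₂, e₃, rfl⟩ f
  have hj₀ : τ .j0 = J 0 := by rw [e₁, hJ]; simp [hsIndex]
  have hjl : τ .jl = J (Q - 1) := by
    rw [e₂, hJ, hsIndex, hQ, Nat.cast_sub (by omega)]
    rfl
  have hper : ∀ i v : ℕ, J (Q * v + i) = J i + v * σ .tt := hsIndex_add_mul hq Q hQ
  have hJlt : ∀ i < Q, J i < σ .tt := by
    intro i hi
    rw [hJ, hsIndex, Int.ediv_lt_iff_lt_mul hq, hQ]
    have : (i : ℤ) + 1 ≤ Q := by exact_mod_cast hi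
    nlinarith
  have fo : τ .o = σ .o := f _ rfl
  have ft : τ .tt = σ .tt := f _ rfl
  have fq : τ .qh = σ .qh := f _ rfl
  have fT : τ .top = M := (f _ rfl).trans hM
  have henum : ∀ υ : Store, υ .o = σ .o → υ .tt = σ .tt → υ .qh = σ .qh → υ .top = M →
      WP enumerate υ fun ρ n => ρ .acc = ∑ i ∈ Finset.range Q,
        (if J i + υ .off < M then J i + υ .off else 0) ∧ n ≤ 13 * Q + 8 := by
    intro υ h₁ h₂ h₃ h₄
    have := wp_enumerate υ Q (h₃.trans hQ) (h₃ ▸ hq) (h₂ ▸ ht.le)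
    rwa [h₁, h₂, h₃, h₄] at this
  have hsingle : (M : ℤ) ≤ J Q → WP (block [enumerate, .corr ≔ Reg.acc]) τ fun υ n =>
      (∃ K : ℕ, (∀ i ≥ K, (M : ℤ) ≤ J i) ∧
        υ .corr = ∑ i ∈ Finset.range K, (if J i < M then J i else 0)) ∧ n ≤ 13 * Q + 9 := by
    intro hle
    simp only [wp_block_cons, wp_block_nil, wp_assign]
    refine (henum τ fo ft fq fT).call ?_
    rintro υ n ⟨hacc, hn⟩ -
    refine ⟨⟨Q, fun i hi => hle.trans (hmono hi), ?_⟩, by simp; omega⟩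
    simp [hacc, e₃]
  simp only [List.drop_succ_cons, List.drop_zero]
  rw [wp_block_cons, wp_ite]
  simp only [wp_block_nil]
  refine ⟨fun hle => ?_, fun hgt => ?_⟩
  · simp only [Test.holds, Exp.eval_reg, fT, hj₀] at hle
    refine WP.call (R := fun υ n => υ .corr = 0 ∧ n = 1) (by simp) ?_
    rintro υ _ ⟨hc, rfl⟩ -
    exact ⟨⟨0, fun i hi => hle.trans (hmono hi), by simpa using hc⟩, by simp⟩
  rw [wp_ite]
  refine ⟨fun hle => ?_, fun hgt' => ?_⟩
  · simp only [Test.holds, Exp.eval_reg, fT, hjl] at hle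
    refine (hsingle (hle.trans (hmono (by omega)))).call ?_
    rintro υ n ⟨h, hn⟩ -
    exact ⟨h, by simp; omega⟩
  have hJQ : J Q = J 0 + σ .tt := by simpa using hper 0 1
  rw [wp_ite]
  refine ⟨fun hle => ?_, fun hgt'' => ?_⟩
  · simp only [Test.holds, Exp.eval_reg, Exp.eval_add, fT, hj₀, ft, ← hJQ] at hle
    refine (hsingle hle).call ?_
    rintro υ n ⟨h, hn⟩ -
    exact ⟨h, by simp; omega⟩
  simp only [Test.holds, Exp.eval_reg, Exp.eval_add, fT, hj₀, ft, not_le] at hgt''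
  have hJ₀ : 0 ≤ J 0 := by rw [hJ]; exact Int.ediv_nonneg (by simpa using ho) hq.le
  simp only [wp_block_cons, wp_block_nil]
  refine WP.call (R := fun υ n => υ .u = (M - 1) / σ .tt ∧ n = 3) (by simp [fT, ft]) ?_
  rintro τ₁ _ ⟨hu, rfl⟩ f₁
  obtain ⟨u, hu'⟩ : ∃ u : ℕ, ((M : ℤ) - 1) / σ .tt = u :=
    ⟨_, (Int.toNat_of_nonneg (Int.ediv_nonneg (by linarith) ht.le)).symm⟩
  rw [hu'] at hu
  have hu₁ : (u : ℤ) * σ .tt ≤ M - 1 := by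
    rw [← hu', mul_comm]; exact Int.mul_ediv_self_le ht.ne'
  have hu₂ : (M : ℤ) - 1 < u * σ .tt + σ .tt := by
    rw [← hu', mul_comm]; exact Int.lt_mul_ediv_self_add ht
  refine (henum τ₁ (by rw [f₁ _ rfl, fo]) (by rw [f₁ _ rfl, ft]) (by rw [f₁ _ rfl, fq])
    (by rw [f₁ _ rfl, fT])).call ?_
  rintro τ₂ n₂ ⟨ha, hn₂⟩ f₂
  refine WP.call (R := fun υ n => υ .accJ = τ₂ .acc ∧ n = 1) (by simp) ?_
  rintro τ₃ _ ⟨haJ, rfl⟩ f₃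
  refine WP.call (R := fun υ n => υ .off = τ₃ .u * τ₃ .tt ∧ n = 2) (by simp) ?_
  rintro τ₄ _ ⟨hoff, rfl⟩ f₄
  refine (henum τ₄ (by rw [f₄ _ rfl, f₃ _ rfl, f₂ _ rfl, f₁ _ rfl, fo])
    (by rw [f₄ _ rfl, f₃ _ rfl, f₂ _ rfl, f₁ _ rfl, ft])
    (by rw [f₄ _ rfl, f₃ _ rfl, f₂ _ rfl, f₁ _ rfl, fq])
    (by rw [f₄ _ rfl, f₃ _ rfl, f₂ _ rfl, f₁ _ rfl, fT])).call ?_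
  rintro τ₅ n₅ ⟨hb, hn₅⟩ f₅
  refine WP.call (R := fun υ n => υ .corr = τ₅ .u * τ₅ .accJ +
    τ₅ .qh * τ₅ .tt * ((τ₅ .u - 1) * τ₅ .u / 2) + τ₅ .acc ∧ n = 9) (by simp) ?_
  rintro τ₆ _ ⟨hc, rfl⟩ -
  -- The periods before number `u` lie entirely below `M`, period `u` may be cut by `M`, and all
  -- later ones lie above.
  have hK : J (Q * (u + 1)) = J 0 + (u + 1 : ℕ) * σ .tt := hper 0 (u + 1)
  refine ⟨⟨Q * (u + 1), fun i hi => ?_, ?_⟩, by simp; omega⟩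
  · refine le_trans ?_ (hmono hi)
    rw [hK]
    push_cast
    linarith
  have tt₃ : τ₃ .tt = σ .tt := by rw [f₃ _ rfl, f₂ _ rfl, f₁ _ rfl, ft]
  have u₃ : τ₃ .u = u := by rw [f₃ _ rfl, f₂ _ rfl, hu]
  have hfull : τ₃ .accJ = ∑ i ∈ Finset.range Q, J i := by
    rw [haJ, ha]
    refine Finset.sum_congr rfl fun i hi => ?_
    have := hJlt i (Finset.mem_range.1 hi)
    rw [f₁ _ rfl, e₃, add_zero, if_pos]
    linarith
  rw [hc, f₅ .u rfl, f₄ .u rfl, u₃, f₅ .accJ rfl, f₄ .accJ rfl, hfull, f₅ .tt rfl, f₄ .tt rfl, tt₃,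
    f₅ .qh rfl, f₄ .qh rfl, f₃ .qh rfl, f₂ .qh rfl, f₁ .qh rfl, fq, hb, hoff, u₃, tt₃,
    ← sum_hsIndex_period hq Q hQ u, Nat.mul_succ, Finset.sum_range_add]
  congr 1
  · refine Finset.sum_congr rfl fun i hi => (if_pos ?_).symm
    have hi' := Finset.mem_range.1 hi
    obtain ⟨v, r, hr, rfl⟩ : ∃ v r : ℕ, r < Q ∧ i = Q * v + r :=
      ⟨i / Q, i % Q, Nat.mod_lt _ (by omega), (Nat.div_add_mod i Q).symm⟩
    have hv : v + 1 ≤ u := by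
      by_contra hcon
      have : Q * u ≤ Q * v := Nat.mul_le_mul_left Q (by omega)
      omega
    have hv' : (v : ℤ) + 1 ≤ u := by exact_mod_cast hv
    rw [hper]
    have := hJlt r hr
    nlinarith
  · refine Finset.sum_congr rfl fun i _ => ?_
    rw [hper]

/-! ## The discrete sums -/

/-- The value `j` is reached at `k = ⌈(j q - s) / t⌉`, and `M` is the last value. The deviation of
each gap from `q / t` is collected in the remaining sum. -/
theorem sum_floor_add {s t q : ℤ} (hs : 0 ≤ s) (hsq : s < q) (ht : 0 < t) (N M : ℕ)
    (hM : (s + N * t) / q = M) :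
    ∑ k ∈ Finset.range (N + 1), (s + k * t) / q =
      q / t * ((M : ℤ) * (M - 1) / 2) + M * (N - -((s - M * q) / t) + 1) +
        ∑ j ∈ Finset.range M,
          (j : ℤ) * ((s - j * q) / t - (s - ((j + 1 : ℕ) : ℤ) * q) / t - q / t) := by
  have hq : 0 < q := by linarith
  have hmono : ∀ k ≤ N, (s + (k : ℤ) * t) / q ≤ M := by
    intro k hk
    rw [← hM]
    apply Int.ediv_le_ediv hq
    have : (k : ℤ) ≤ N := by exact_mod_cast hk
    nlinarith
  have hx : ∀ (j k : ℕ), ((j : ℤ) ≤ (s + k * t) / q ↔ -((s - j * q) / t) ≤ (k : ℤ)) := by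
    intro j k
    rw [Int.le_ediv_iff_mul_le hq, show s - j * q = -(j * q - s) by ring, le_neg_ediv_neg_iff ht]
    constructor <;> intro h <;> linarith
  rw [sum_eq_sum_thresholds N M (fun k => (s + k * t) / q) (fun j => -((s - j * q) / t))
    (fun k _ => Int.ediv_nonneg (by positivity) hq.le) hmono (fun j _ _ k _ => hx j k) ?_,
    sum_thresholds_eq _ (q / t) (fun j => -((s - j * q) / t))
    (fun j => (s - j * q) / t - (s - ((j + 1 : ℕ) : ℤ) * q) / t - q / t) M
    (fun j _ _ => by ring)]
  · ring
  · intro j h₁ h₂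
    constructor
    · have h₁' : (1 : ℤ) ≤ j := by exact_mod_cast h₁
      have : (s - j * q) / t ≤ 0 := by
        rw [← Int.lt_add_one_iff, Int.ediv_lt_iff_lt_mul ht]
        nlinarith
      linarith
    · have := (hx j N).1 (by rw [hM]; exact_mod_cast h₂)
      linarith

/-- The negated summand reaches `j` when `k t` strictly exceeds `s + (j - 1) q`; strictness turns
the ceiling of the increasing case into a floor plus one. -/
theorem sum_floor_sub {s t q : ℤ} (hs : 0 ≤ s) (hsq : s < q) (ht : 0 < t) (N M : ℕ)
    (hM : 0 - (s - N * t) / q = M) :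
    ∑ k ∈ Finset.range (N + 1), (s - k * t) / q =
      0 - q / t * ((M : ℤ) * (M - 1) / 2) - M * (N - (s + (M - 1) * q) / t) -
        ∑ j ∈ Finset.range M,
          (j : ℤ) * ((s + (((j + 1 : ℕ) : ℤ) - 1) * q) / t - (s + ((j : ℤ) - 1) * q) / t - q / t)
          := by
  have hq : 0 < q := by linarith
  have hx : ∀ (j k : ℕ), ((j : ℤ) ≤ -((s - k * t) / q) ↔ (s + (j - 1) * q) / t + 1 ≤ (k : ℤ)) := by
    intro j k
    rw [le_neg, ← Int.lt_add_one_iff, Int.ediv_lt_iff_lt_mul hq, Int.add_one_le_iff,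
      Int.ediv_lt_iff_lt_mul ht]
    constructor <;> intro h <;> linarith
  have h₀ : ∀ k : ℕ, 0 ≤ -((s - (k : ℤ) * t) / q) := by
    intro k
    rw [le_neg, neg_zero, ← Int.lt_add_one_iff, Int.ediv_lt_iff_lt_mul hq]
    have : 0 ≤ (k : ℤ) * t := by positivity
    linarith
  have hmono : ∀ k ≤ N, -((s - (k : ℤ) * t) / q) ≤ M := by
    intro k hk
    rw [← hM, zero_sub, neg_le_neg_iff]
    apply Int.ediv_le_ediv hq
    have : (k : ℤ) ≤ N := by exact_mod_cast hk
    nlinarith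
  have key := sum_eq_sum_thresholds N M (fun k => -((s - k * t) / q))
    (fun j => (s + (j - 1) * q) / t + 1) (fun k _ => h₀ k) hmono (fun j _ _ k _ => hx j k) ?_
  · rw [sum_thresholds_eq _ (q / t) (fun j => (s + (j - 1) * q) / t + 1)
      (fun j => (s + (((j + 1 : ℕ) : ℤ) - 1) * q) / t - (s + ((j : ℤ) - 1) * q) / t - q / t) M
      (fun j _ _ => by ring), Finset.sum_neg_distrib] at key
    rw [eq_comm, ← neg_eq_iff_eq_neg] at key
    rw [← key]
    ring
  · intro j h₁ h₂
    constructor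
    · have h₁' : (1 : ℤ) ≤ j := by exact_mod_cast h₁
      have : 0 ≤ (s + (j - 1) * q) / t := Int.ediv_nonneg (by nlinarith) ht.le
      linarith
    · have := (hx j N).1 (by rw [← zero_sub, hM]; exact_mod_cast h₂)
      linarith

/-- The parameters of `hSParameters`. -/
theorem gcd_parameters {t q : ℤ} (ht : 0 < t) :
    0 < (Int.gcd t q : ℤ) ∧ 0 < t / Int.gcd t q ∧ t = Int.gcd t q * (t / Int.gcd t q) ∧
      q = Int.gcd t q * (q / Int.gcd t q) ∧ q / Int.gcd t q / (t / Int.gcd t q) = q / t := by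
  have hg : 0 < (Int.gcd t q : ℤ) := by exact_mod_cast Int.gcd_pos_of_ne_zero_left q ht.ne'
  have h₁ : t = Int.gcd t q * (t / Int.gcd t q) := (Int.mul_ediv_cancel' (Int.gcd_dvd_left ..)).symm
  have h₂ : q = Int.gcd t q * (q / Int.gcd t q) :=
    (Int.mul_ediv_cancel' (Int.gcd_dvd_right ..)).symm
  refine ⟨hg, Int.ediv_pos_of_pos_of_dvd ht hg.le (Int.gcd_dvd_left ..), h₁, h₂, ?_⟩
  rw [Int.ediv_ediv_of_nonneg hg.le, ← h₁]

theorem wp_hSParameters (σ : Store) (T : ℕ) (hT : σ .t = T) (htq : σ .t < σ .q) :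
    WP hSParameters σ fun τ n =>
      τ .tt = σ .t / Int.gcd (σ .t) (σ .q) ∧
      τ .qh = σ .q / Int.gcd (σ .t) (σ .q) % (σ .t / Int.gcd (σ .t) (σ .q)) ∧
      τ .sh = σ .s / Int.gcd (σ .t) (σ .q) % (σ .t / Int.gcd (σ .t) (σ .q)) ∧
      n ≤ 13 * T + 26 := by
  have h₀ : 0 ≤ σ .t := by omega
  unfold hSParameters
  refine WP.split 2 (WP.call (R := fun τ n => τ .r0 = σ .t ∧ τ .r1 = σ .q ∧ n = 2) (by simp) ?_)
  rintro τ _ ⟨e₁, e₂, rfl⟩ f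
  simp only [List.drop_succ_cons, List.drop_zero]
  refine WP.split 1 ?_
  simp only [List.drop_succ_cons, List.drop_zero, List.take_succ_cons, List.take_zero,
    wp_block_cons, wp_block_nil]
  refine (wp_euclid_linear T τ (by omega) (by omega) (by omega) (by omega)).call ?_
  rintro υ n ⟨g₁, -, hn⟩ f'
  rw [e₁, e₂] at g₁
  simp only [wp_assign, Exp.eval_div, Exp.eval_mod, Exp.eval_reg, Function.update_apply]
  simp [g₁, f' .s, f' .t, f' .q, f .s, f .t, f .q, euclid, block, Cmd.writes]
  omega

/-- For `q % t ≠ 0`, the reduced remainder of `q` is positive and less than `tt`. -/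
theorem reduced_remainder {t q : ℤ} (ht : 0 < t) (hr : q % t ≠ 0) :
    0 < q / Int.gcd t q % (t / Int.gcd t q) ∧
      q / Int.gcd t q % (t / Int.gcd t q) < t / Int.gcd t q := by
  obtain ⟨hg, htt, h₁, h₂, h₃⟩ := gcd_parameters (q := q) ht
  refine ⟨lt_of_le_of_ne (Int.emod_nonneg _ htt.ne') fun h => hr ?_, Int.emod_lt_of_pos _ htt⟩
  have := Int.mul_ediv_cancel' (Int.dvd_of_emod_eq_zero h.symm)
  rw [h₃] at this
  apply Int.emod_eq_zero_of_dvd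
  refine ⟨q / t, ?_⟩
  calc q = Int.gcd t q * (q / Int.gcd t q) := h₂
    _ = Int.gcd t q * (t / Int.gcd t q * (q / t)) := by rw [this]
    _ = t * (q / t) := by rw [← mul_assoc, ← h₁]

/-- Apart from a constant and a multiple of `q / t`, the threshold is the counting function of the
enumeration with offset `sh`. In differences of consecutive thresholds only the latter survives. -/
theorem floor_sub_eq_count {s t q : ℤ} (ht : 0 < t) (j : ℤ) :
    (s - j * q) / t = s / Int.gcd t q / (t / Int.gcd t q) - j * (q / t) - 1 -
      (j * (q / Int.gcd t q % (t / Int.gcd t q)) - s / Int.gcd t q % (t / Int.gcd t q) - 1) /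
        (t / Int.gcd t q) := by
  obtain ⟨hg, htt, h₁, h₂, h₃⟩ := gcd_parameters (q := q) ht
  have h := ediv_reduce s (q / Int.gcd t q) (-j) hg htt
  rw [← h₁, ← h₂, h₃, show s + -j * q = s - j * q by ring] at h
  rw [h, ← sub_eq_zero]
  have h' := neg_ediv_of_pos
    (j * (q / Int.gcd t q % (t / Int.gcd t q)) - s / Int.gcd t q % (t / Int.gcd t q)) htt
  rw [show s / Int.gcd t q % (t / Int.gcd t q) + -j * (q / Int.gcd t q % (t / Int.gcd t q)) =
    -(j * (q / Int.gcd t q % (t / Int.gcd t q)) - s / Int.gcd t q % (t / Int.gcd t q)) by ring, h']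
  ring

/-- Here the offset is `qh - 1 - sh` modulo `tt`; the free integer `e` allows the representative in
`[0, tt)` to be chosen. -/
theorem floor_add_eq_count {s t q : ℤ} (ht : 0 < t) (j e : ℤ) :
    (s + (j - 1) * q) / t =
      (j * (q / Int.gcd t q % (t / Int.gcd t q)) - (t / Int.gcd t q * e +
        q / Int.gcd t q % (t / Int.gcd t q) - 1 - s / Int.gcd t q % (t / Int.gcd t q)) - 1) /
        (t / Int.gcd t q) + e + s / Int.gcd t q / (t / Int.gcd t q) + (j - 1) * (q / t) := by
  obtain ⟨hg, htt, h₁, h₂, h₃⟩ := gcd_parameters (q := q) ht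
  have h := ediv_reduce s (q / Int.gcd t q) (j - 1) hg htt
  rw [← h₁, ← h₂, h₃] at h
  rw [h]
  generalize t / (Int.gcd t q : ℤ) = tt at htt ⊢
  generalize q / (Int.gcd t q : ℤ) % tt = qh
  generalize s / (Int.gcd t q : ℤ) % tt = sh
  rw [← Int.add_mul_ediv_left _ e htt.ne',
    show j * qh - (tt * e + qh - 1 - sh) - 1 + tt * e = sh + (j - 1) * qh by ring]

theorem add_mul_ediv_of_emod_eq_zero {q t : ℤ} (s j : ℤ) (ht : 0 < t) (hr : q % t = 0) :
    (s + j * q) / t = s / t + j * (q / t) := by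
  obtain ⟨k, rfl⟩ := Int.dvd_of_emod_eq_zero hr
  rw [show s + j * (t * k) = s + t * (j * k) by ring, Int.add_mul_ediv_left _ _ ht.ne',
    Int.mul_ediv_cancel_left _ ht.ne']

theorem wp_sPlus (σ : Store) (T N : ℕ) (hs : 0 ≤ σ .s) (hsq : σ .s < σ .q) (hT : σ .t = T)
    (htq : σ .t < σ .q) (hN : σ .n = N) :
    WP sPlus σ fun τ n =>
      τ .res = ∑ k ∈ Finset.range (N + 1), (σ .s + k * σ .t) / σ .q ∧ n ≤ 39 * T + 110 := by
  have hq : 0 < σ .q := by linarith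
  unfold sPlus
  rw [wp_ite]
  refine ⟨fun h => ?_, fun h => ?_⟩
  · simp only [Test.holds, Exp.eval_reg, Exp.eval_zero] at h
    refine WP.call (R := fun τ n => τ .res = 0 ∧ n = 1) (by simp) ?_
    rintro τ _ ⟨hr, rfl⟩ -
    simp only [h, mul_zero, add_zero, Int.ediv_eq_zero_of_lt hs hsq, Finset.sum_const_zero]
    exact ⟨hr, by simp⟩
  simp only [Test.holds, Exp.eval_reg, Exp.eval_zero] at h
  have ht : 0 < σ .t := by omega
  obtain ⟨M, hM⟩ : ∃ M : ℕ, (σ .s + N * σ .t) / σ .q = M :=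
    ⟨_, (Int.toNat_of_nonneg (Int.ediv_nonneg (by positivity) hq.le)).symm⟩
  rw [sum_floor_add hs hsq ht N M hM]
  refine WP.split 3 (WP.call (R := fun τ n => τ .top = M ∧ τ .base =
    σ .q / σ .t * ((M : ℤ) * (M - 1) / 2) + M * (N - -((σ .s - M * σ .q) / σ .t) + 1) ∧ n = 19)
    (by simp [hM, hN]) ?_)
  rintro τ _ ⟨e₁, e₂, rfl⟩ f
  have fs : τ .s = σ .s := f _ rfl
  have ft : τ .t = σ .t := f _ rfl
  have fq : τ .q = σ .q := f _ rfl
  simp only [List.drop_succ_cons, List.drop_zero]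
  rw [wp_block_cons, wp_ite]
  simp only [wp_block_nil]
  refine ⟨fun h => ?_, fun h => ?_⟩
  -- If `t` divides `q`, then `qh` would be `0` and could not serve as a divisor; all gaps equal `q
  -- / t`, so no correction is due.
  · simp only [Test.holds, Exp.eval_mod, Exp.eval_reg, Exp.eval_zero, ft, fq] at h
    refine WP.call (R := fun υ n => υ .res = τ .base ∧ n = 1) (by simp) ?_
    rintro υ _ ⟨hr, rfl⟩ -
    refine ⟨?_, by simp⟩
    rw [hr, e₂, Finset.sum_eq_zero, add_zero]
    intro j _
    have h₁ := add_mul_ediv_of_emod_eq_zero (σ .s) (-j) ht h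
    have h₂ := add_mul_ediv_of_emod_eq_zero (σ .s) (-((j + 1 : ℕ) : ℤ)) ht h
    rw [neg_mul, ← sub_eq_add_neg] at h₁ h₂
    rw [h₁, h₂]
    push_cast
    ring
  simp only [Test.holds, Exp.eval_mod, Exp.eval_reg, Exp.eval_zero, ft, fq] at h
  obtain ⟨hg, htt, -⟩ := gcd_parameters (q := σ .q) ht
  obtain ⟨hq₀, hq₁⟩ := reduced_remainder ht h
  simp only [wp_block_cons, wp_block_nil]
  refine (wp_hSParameters τ T (ft.trans hT) (by rw [ft, fq]; exact htq)).call ?_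
  rw [fs, ft, fq]
  rintro τ₁ n₁ ⟨a₁, a₂, a₃, hn₁⟩ f₁
  refine WP.call (R := fun υ n => υ .o = τ₁ .sh ∧ n = 1) (by simp) ?_
  rintro τ₂ _ ⟨ho, rfl⟩ f₂
  have b₁ := (f₂ .tt rfl).trans a₁
  have b₂ := (f₂ .qh rfl).trans a₂
  have b₃ := ho.trans a₃
  -- A period has `qh < tt ≤ t` members, so the correction costs time linear in `t`, independently
  -- of `n` and `q`.
  have hqT : τ₂ .qh ≤ T := by
    have : σ .t / Int.gcd (σ .t) (σ .q) ≤ σ .t := Int.ediv_le_self _ ht.le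
    rw [b₂]
    omega
  refine (wp_hSCorrection τ₂ (τ₂ .qh).toNat M (Int.toNat_of_nonneg (by omega)).symm
    (by omega) (by rw [b₃]; exact Int.emod_nonneg _ htt.ne')
    (by rw [b₃, b₁]; exact Int.emod_lt_of_pos _ htt)
    (by rw [f₂ _ rfl, f₁ _ rfl, e₁])).call ?_
  rintro τ₃ n₃ ⟨hc, hn₃⟩ f₃
  refine WP.call (R := fun υ n => υ .res = τ₃ .base + τ₃ .corr ∧ n = 2) (by simp) ?_
  rintro τ₄ _ ⟨hr, rfl⟩ -
  refine ⟨?_, by simp; omega⟩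
  rw [hr, f₃ .base rfl, f₂ .base rfl, f₁ .base rfl, e₂, hc, b₁, b₂, b₃]
  congr 1
  refine Finset.sum_congr rfl fun j _ => ?_
  rw [floor_sub_eq_count ht j, floor_sub_eq_count ht ((j + 1 : ℕ) : ℤ)]
  push_cast
  ring

theorem wp_sMinus (σ : Store) (T N : ℕ) (hs : 0 ≤ σ .s) (hsq : σ .s < σ .q) (hT : σ .t = T)
    (htq : σ .t < σ .q) (hN : σ .n = N) :
    WP sMinus σ fun τ n =>
      τ .res = ∑ k ∈ Finset.range (N + 1), (σ .s - k * σ .t) / σ .q ∧ n ≤ 39 * T + 120 := by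
  have hq : 0 < σ .q := by linarith
  unfold sMinus
  rw [wp_ite]
  refine ⟨fun h => ?_, fun h => ?_⟩
  · simp only [Test.holds, Exp.eval_reg, Exp.eval_zero] at h
    refine WP.call (R := fun τ n => τ .res = 0 ∧ n = 1) (by simp) ?_
    rintro τ _ ⟨hr, rfl⟩ -
    simp only [h, mul_zero, sub_zero, Int.ediv_eq_zero_of_lt hs hsq, Finset.sum_const_zero]
    exact ⟨hr, by simp⟩
  simp only [Test.holds, Exp.eval_reg, Exp.eval_zero] at h
  have ht : 0 < σ .t := by omega
  obtain ⟨M, hM⟩ : ∃ M : ℕ, 0 - (σ .s - N * σ .t) / σ .q = M := by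
    refine ⟨_, (Int.toNat_of_nonneg ?_).symm⟩
    have : (σ .s - N * σ .t) / σ .q < 1 := by
      rw [Int.ediv_lt_iff_lt_mul hq]
      have : 0 ≤ (N : ℤ) * σ .t := by positivity
      linarith
    omega
  rw [sum_floor_sub hs hsq ht N M hM]
  refine WP.split 3 (WP.call (R := fun τ n => τ .top = M ∧ τ .base =
    0 - σ .q / σ .t * ((M : ℤ) * (M - 1) / 2) - M * (N - (σ .s + (M - 1) * σ .q) / σ .t) ∧ n = 20)
    (by rw [← hM]; simp [hN]) ?_)
  rintro τ _ ⟨e₁, e₂, rfl⟩ f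
  have fs : τ .s = σ .s := f _ rfl
  have ft : τ .t = σ .t := f _ rfl
  have fq : τ .q = σ .q := f _ rfl
  simp only [List.drop_succ_cons, List.drop_zero]
  rw [wp_block_cons, wp_ite]
  simp only [wp_block_nil]
  refine ⟨fun h => ?_, fun h => ?_⟩
  · simp only [Test.holds, Exp.eval_mod, Exp.eval_reg, Exp.eval_zero, ft, fq] at h
    refine WP.call (R := fun υ n => υ .res = τ .base ∧ n = 1) (by simp) ?_
    rintro υ _ ⟨hr, rfl⟩ -
    refine ⟨?_, by simp⟩
    rw [hr, e₂, Finset.sum_eq_zero, sub_zero]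
    intro j _
    rw [add_mul_ediv_of_emod_eq_zero _ _ ht h, add_mul_ediv_of_emod_eq_zero _ _ ht h]
    push_cast
    ring
  simp only [Test.holds, Exp.eval_mod, Exp.eval_reg, Exp.eval_zero, ft, fq] at h
  obtain ⟨hg, htt, h₁, h₂, h₃⟩ := gcd_parameters (q := σ .q) ht
  obtain ⟨hq₀, hq₁⟩ := reduced_remainder ht h
  simp only [wp_block_cons, wp_block_nil]
  refine (wp_hSParameters τ T (ft.trans hT) (by rw [ft, fq]; exact htq)).call ?_
  rw [fs, ft, fq]
  rintro τ₁ n₁ ⟨a₁, a₂, a₃, hn₁⟩ f₁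
  have hs₀ := Int.emod_nonneg (σ .s / Int.gcd (σ .t) (σ .q)) htt.ne'
  have hs₁ := Int.emod_lt_of_pos (σ .s / Int.gcd (σ .t) (σ .q)) htt
  rw [← a₃, ← a₁] at hs₁
  rw [← a₃] at hs₀
  -- Both branches are covered at once, with `e = 0` if `sh < qh` and `e = 1` otherwise.
  refine WP.call (R := fun υ n => (0 ≤ υ .o ∧ υ .o < τ₁ .tt ∧
    ∃ e : ℤ, υ .o = τ₁ .tt * e + τ₁ .qh - 1 - τ₁ .sh) ∧ n ≤ 5) ?_ ?_
  · rw [wp_ite]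
    rw [← a₂] at hq₀
    rw [← a₂, ← a₁] at hq₁
    refine ⟨fun h => ?_, fun h => ?_⟩
    · simp only [Test.holds, Exp.eval_reg] at h
      refine WP.call (R := fun υ n => υ .o = τ₁ .qh - 1 - τ₁ .sh ∧ n = 3) (by simp) ?_
      rintro υ _ ⟨ho, rfl⟩ -
      exact ⟨⟨by omega, by omega, 0, by omega⟩, by simp⟩
    · simp only [Test.holds, Exp.eval_reg] at h
      refine WP.call (R := fun υ n => υ .o = τ₁ .tt + τ₁ .qh - 1 - τ₁ .sh ∧ n = 4) (by simp) ?_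
      rintro υ _ ⟨ho, rfl⟩ -
      exact ⟨⟨by omega, by omega, 1, by omega⟩, by simp⟩
  rintro τ₂ n₂ ⟨⟨ho₀, ho₁, e, ho⟩, hn₂⟩ f₂
  have b₁ := (f₂ .tt rfl).trans a₁
  have b₂ := (f₂ .qh rfl).trans a₂
  rw [a₁, a₂, a₃] at ho
  have hqT : τ₂ .qh ≤ T := by
    have : σ .t / Int.gcd (σ .t) (σ .q) ≤ σ .t := Int.ediv_le_self _ ht.le
    rw [b₂]
    omega
  refine (wp_hSCorrection τ₂ (τ₂ .qh).toNat M (Int.toNat_of_nonneg (by omega)).symm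
    (by omega) ho₀ (by rw [f₂ .tt rfl]; exact ho₁)
    (by rw [f₂ _ rfl, f₁ _ rfl, e₁])).call ?_
  rintro τ₃ n₃ ⟨hc, hn₃⟩ f₃
  refine WP.call (R := fun υ n => υ .res = τ₃ .base - τ₃ .corr ∧ n = 2) (by simp) ?_
  rintro τ₄ _ ⟨hr, rfl⟩ -
  refine ⟨?_, by simp; omega⟩
  rw [hr, f₃ .base rfl, f₂ .base rfl, f₁ .base rfl, e₂, hc, b₁, b₂, ho]
  congr 1
  refine Finset.sum_congr rfl fun j _ => ?_
  rw [floor_add_eq_count ht _ e, floor_add_eq_count ht _ e]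
  push_cast
  ring

/-! ## The lattice of an L-shape -/

/-- By Bézout, `c` divides `gcd(a, b) P`, and that gcd is coprime to `c`. This is where the
coprimality of the generators enters the lattice argument. -/
theorem dvd_of_dvd_mul_of_gcd_eq_one {a b c : ℕ} (hg : (a.gcd b).gcd c = 1) {P : ℤ}
    (ha : (c : ℤ) ∣ a * P) (hb : (c : ℤ) ∣ b * P) : (c : ℤ) ∣ P := by
  have h : (c : ℤ) ∣ (a.gcd b : ℕ) * P := by
    rw [Nat.gcd_eq_gcd_ab, add_mul, mul_right_comm, mul_right_comm (b : ℤ)]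
    exact dvd_add (ha.mul_right _) (hb.mul_right _)
  refine IsCoprime.dvd_of_dvd_mul_left ?_ h
  rw [Int.isCoprime_iff_gcd_eq_one, Int.gcd_natCast_natCast, Nat.gcd_comm, hg]

/-- The vectors `(l, -y)` and `(-w, h)` span the lattice of all vectors with label `0`. -/
theorem exists_coords {a b c : ℕ} (hc : 0 < c) (hg : (a.gcd b).gcd c = 1) {l h w y : ℤ}
    (area : l * h = w * y + c) (hu : (c : ℤ) ∣ l * a - y * b) (hv : (c : ℤ) ∣ h * b - w * a)
    {dx dy : ℤ} (hd : (c : ℤ) ∣ dx * a + dy * b) :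
    ∃ α β : ℤ, dx = α * l - β * w ∧ dy = β * h - α * y := by
  have hc' : (c : ℤ) ≠ 0 := by exact_mod_cast hc.ne'
  -- Cramer's rule: the determinant is `l h - w y = c`, so both numerators must be divisible by `c`.
  obtain ⟨α, hα⟩ : (c : ℤ) ∣ h * dx + w * dy := by
    apply dvd_of_dvd_mul_of_gcd_eq_one hg
    · rw [show (a : ℤ) * (h * dx + w * dy) = h * (dx * a + dy * b) - dy * (h * b - w * a) by ring]
      exact dvd_sub (hd.mul_left _) (hv.mul_left _)
    · rw [show (b : ℤ) * (h * dx + w * dy) = w * (dx * a + dy * b) + dx * (h * b - w * a) by ring]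
      exact dvd_add (hd.mul_left _) (hv.mul_left _)
  obtain ⟨β, hβ⟩ : (c : ℤ) ∣ y * dx + l * dy := by
    apply dvd_of_dvd_mul_of_gcd_eq_one hg
    · rw [show (a : ℤ) * (y * dx + l * dy) = y * (dx * a + dy * b) + dy * (l * a - y * b) by ring]
      exact dvd_add (hd.mul_left _) (hu.mul_left _)
    · rw [show (b : ℤ) * (y * dx + l * dy) = l * (dx * a + dy * b) - dx * (l * a - y * b) by ring]
      exact dvd_sub (hd.mul_left _) (hu.mul_left _)
  refine ⟨α, β, mul_left_cancel₀ hc' ?_, mul_left_cancel₀ hc' ?_⟩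
  · linear_combination l * hα - w * hβ - dx * area
  · linear_combination h * hβ - y * hα - dy * area

/-- A translate of a square of an L-shape that lies in the first quadrant is reached by a
non-negative combination of `(l, -y)` and `(-w, h)`. -/
theorem coords_nonneg {l h w y x₀ y₀ α β : ℤ} (hw₀ : 0 ≤ w) (hw : w < l) (hy₀ : 0 ≤ y) (hy : y < h)
    (hx : x₀ < l) (hy' : y₀ < h) (hL : x₀ + w < l ∨ y₀ + y < h)
    (hX : 0 ≤ x₀ + (α * l - β * w)) (hY : 0 ≤ y₀ + (β * h - α * y)) : 0 ≤ α ∧ 0 ≤ β := by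
  -- If `α < β` with `α < 0`, the first coordinate is negative, and symmetrically for `β < α`. If `α
  -- = β < 0`, the square would have to lie in the removed corner, contrary to `hL`.
  rcases lt_trichotomy α β with hlt | rfl | hlt
  · suffices 0 ≤ α by omega
    by_contra hneg
    obtain ⟨i, rfl⟩ : ∃ i, β = α + 1 + i := ⟨β - α - 1, by ring⟩
    have hi : 0 ≤ i := by omega
    have h₁ : α * (l - w) ≤ -1 * (l - w) := mul_le_mul_of_nonneg_right (by omega) (by omega)
    have h₂ : 0 ≤ i * w := by positivity
    linarith
  · suffices 0 ≤ α from ⟨this, this⟩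
    by_contra hneg
    have h₁ : α * (l - w) ≤ -1 * (l - w) := mul_le_mul_of_nonneg_right (by omega) (by omega)
    have h₂ : α * (h - y) ≤ -1 * (h - y) := mul_le_mul_of_nonneg_right (by omega) (by omega)
    rcases hL with hL | hL <;> linarith
  · suffices 0 ≤ β by omega
    by_contra hneg
    obtain ⟨i, rfl⟩ : ∃ i, α = β + 1 + i := ⟨α - β - 1, by ring⟩
    have hi : 0 ≤ i := by omega
    have h₁ : β * (h - y) ≤ -1 * (h - y) := mul_le_mul_of_nonneg_right (by omega) (by omega)
    have h₂ : 0 ≤ i * y := by positivity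
    linarith

theorem mem_cells {l h w y i j : ℕ} :
    (i, j) ∈ cells l h w y ↔ i < l ∧ j < h ∧ (i + w < l ∨ j + y < h) := by
  simp [cells, and_assoc]

theorem card_cells {l h w y : ℕ} (hw : w ≤ l) (hy : y ≤ h) :
    (cells l h w y).card + w * y = l * h := by
  have hcompl : (Finset.range l ×ˢ Finset.range h).filter
      (fun p => ¬ (p.1 + w < l ∨ p.2 + y < h)) = Finset.Ico (l - w) l ×ˢ Finset.Ico (h - y) h := by
    ext ⟨i, j⟩
    simp only [Finset.mem_filter, Finset.mem_product, Finset.mem_range, Finset.mem_Ico]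
    omega
  have h₁ := Finset.card_filter_add_card_filter_not (s := Finset.range l ×ˢ Finset.range h)
    (fun p => p.1 + w < l ∨ p.2 + y < h)
  rw [hcompl, Finset.card_product, Finset.card_product, Nat.card_Ico, Nat.card_Ico,
    Finset.card_range, Finset.card_range, Nat.sub_sub_self hw, Nat.sub_sub_self hy] at h₁
  exact h₁

/-- A criterion for an L-shape to be related to `⟨a, b, c⟩`. -/
theorem isRelatedLShape_of_le {a b c l h w y : ℕ} (hc : 0 < c) (hg : (a.gcd b).gcd c = 1)
    (hw : w < l) (hy : y < h) (area : l * h = w * y + c) (hu : l * a ≡ y * b [MOD c])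
    (hv : h * b ≡ w * a [MOD c]) (hδ : y * b ≤ l * a) (hθ : w * a ≤ h * b) :
    IsRelatedLShape a b c l h w y := by
  have hu' : (c : ℤ) ∣ (l : ℤ) * a - y * b := by
    have := (Nat.modEq_iff_dvd.1 hu.symm); push_cast at this; exact this
  have hv' : (c : ℤ) ∣ (h : ℤ) * b - w * a := by
    have := (Nat.modEq_iff_dvd.1 hv.symm); push_cast at this; exact this
  have harea : (l : ℤ) * h = w * y + c := by exact_mod_cast area
  have key : ∀ p ∈ cells l h w y, ∀ s t : ℕ, s * a + t * b ≡ p.1 * a + p.2 * b [MOD c] →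
      ∃ α β : ℤ, 0 ≤ α ∧ 0 ≤ β ∧ (s : ℤ) = p.1 + (α * l - β * w) ∧
        (t : ℤ) = p.2 + (β * h - α * y) := by
    rintro ⟨i, j⟩ hp s t hst
    obtain ⟨h₁, h₂, h₃⟩ := mem_cells.1 hp
    have hd := Nat.modEq_iff_dvd.1 hst.symm
    push_cast at hd
    obtain ⟨α, β, e₁, e₂⟩ := exists_coords hc hg harea hu' hv'
      (dx := (s : ℤ) - i) (dy := (t : ℤ) - j) (by convert hd using 1; ring)
    obtain ⟨hα, hβ⟩ := coords_nonneg (l := l) (h := h) (w := w) (y := y) (x₀ := i) (y₀ := j)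
      (α := α) (β := β) (by omega) (by omega) (by omega) (by omega) (by omega) (by omega) (by omega)
      (by rw [← e₁]; omega) (by rw [← e₂]; omega)
    exact ⟨α, β, hα, hβ, by linarith, by linarith⟩
  have hcard : (cells l h w y).card = c := by
    have := card_cells hw.le hy.le
    omega
  refine ⟨hw, hy, area, ⟨hcard, ?_, ?_, ?_⟩, hu, hv⟩
  -- Two squares with the same label differ by non-negative combinations in both directions. These
  -- cancel, so all coefficients vanish; as there are `c` squares, every label occurs.
  · have hinj : Set.InjOn (fun p : ℕ × ℕ => (p.1 * a + p.2 * b) % c) (cells l h w y) := by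
      rintro p hp p' hp' heq
      obtain ⟨α, β, hα, hβ, e₁, e₂⟩ := key p hp p'.1 p'.2 (show _ % c = _ % c from heq.symm)
      obtain ⟨α', β', hα', hβ', e₁', e₂'⟩ := key p' hp' p.1 p.2 heq
      have hc' : (0 : ℤ) < c := by exact_mod_cast hc
      have hs : (α + α') * c = 0 := by
        linear_combination (-h : ℤ) * (e₁ + e₁') - w * (e₂ + e₂') - (α + α') * harea
      have ht : (β + β') * c = 0 := by
        linear_combination (-y : ℤ) * (e₁ + e₁') - l * (e₂ + e₂') - (β + β') * harea
      have hs' := (mul_eq_zero.1 hs).resolve_right hc'.ne'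
      have ht' := (mul_eq_zero.1 ht).resolve_right hc'.ne'
      obtain rfl : α = 0 := by omega
      obtain rfl : β = 0 := by omega
      ext
      · simpa using e₁.symm
      · simpa using e₂.symm
    have himg : (cells l h w y).image (fun p : ℕ × ℕ => (p.1 * a + p.2 * b) % c) =
        Finset.range c := by
      apply Finset.eq_of_subset_of_card_le
      · intro n hn
        obtain ⟨p, _, rfl⟩ := Finset.mem_image.1 hn
        exact Finset.mem_range.2 (Nat.mod_lt _ hc)
      · rw [Finset.card_image_of_injOn hinj, hcard, Finset.card_range]
    intro n hn
    have : n ∈ (cells l h w y).image (fun p : ℕ × ℕ => (p.1 * a + p.2 * b) % c) := by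
      rw [himg]; exact Finset.mem_range.2 hn
    obtain ⟨p, hp, hpn⟩ := Finset.mem_image.1 this
    exact ⟨p, hp, by rw [Nat.ModEq, hpn, Nat.mod_eq_of_lt hn]⟩
  · rintro ⟨i', j'⟩ hp i j hi hj
    rw [mem_cells] at hp ⊢
    omega
  · rintro p hp s t hst
    obtain ⟨α, β, hα, hβ, e₁, e₂⟩ := key p hp s t hst
    have h₁ : (0 : ℤ) ≤ α * (l * a - y * b) :=
      mul_nonneg hα (sub_nonneg.2 (by exact_mod_cast hδ))
    have h₂ : (0 : ℤ) ≤ β * (h * b - w * a) :=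
      mul_nonneg hβ (sub_nonneg.2 (by exact_mod_cast hθ))
    have : (p.1 : ℤ) * a + p.2 * b ≤ s * a + t * b := by
      rw [e₁, e₂]
      linarith
    exact_mod_cast this

/-- The parameters `δ` and `θ` of a related L-shape. -/
theorem IsRelatedLShape.exists_delta_theta {a b c l h w y : ℕ}
    (H : IsRelatedLShape a b c l h w y) :
    ∃ δ θ : ℕ, (l : ℤ) * a - y * b = δ * c ∧ (h : ℤ) * b - w * a = θ * c := by
  -- The square `(0, y)` belongs to the L-shape and `(l, 0)` has the same label, so minimality gives
  -- a non-negative `δ`; likewise `(w, 0)` and `(0, h)` for `θ`.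
  have hδ : y * b ≤ l * a := by
    have := H.isMDD.minimal (0, y) (mem_cells.2 ⟨by have := H.w_lt; omega, H.y_lt,
      .inl (by have := H.w_lt; omega)⟩) l 0 (by simpa using H.u_label)
    simpa using this
  have hθ : w * a ≤ h * b := by
    have := H.isMDD.minimal (w, 0) (mem_cells.2 ⟨H.w_lt, by have := H.y_lt; omega,
      .inr (by have := H.y_lt; omega)⟩) 0 h (by simpa using H.v_label)
    simpa using this
  obtain ⟨δ, h₁⟩ := (Nat.modEq_iff_dvd' hδ).1 H.u_label.symm
  obtain ⟨θ, h₂⟩ := (Nat.modEq_iff_dvd' hθ).1 H.v_label.symm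
  refine ⟨δ, θ, ?_, ?_⟩
  · have : ((l * a - y * b : ℕ) : ℤ) = (c * δ : ℕ) := by rw [h₁]
    rw [Nat.cast_sub hδ] at this
    push_cast at this
    linarith
  · have : ((h * b - w * a : ℕ) : ℤ) = (c * θ : ℕ) := by rw [h₂]
    rw [Nat.cast_sub hθ] at this
    push_cast at this
    linarith

/-- `a = h δ + y θ` and `b = w δ + l θ`. -/
theorem generators_eq {a b c l h w y δ θ : ℤ} (hc : c ≠ 0) (area : l * h = w * y + c)
    (hδ : l * a - y * b = δ * c) (hθ : h * b - w * a = θ * c) :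
    a = h * δ + y * θ ∧ b = w * δ + l * θ := by
  constructor <;> apply mul_left_cancel₀ hc
  · linear_combination h * hδ + y * hθ - a * area
  · linear_combination w * hδ + l * hθ - b * area

/-- The denumerant as a double sum along the diagonals of the lattice. -/
theorem denumerant_eq_sum {a b c l h w y m x₀ y₀ z₀ δ θ : ℕ} (ha : 0 < a) (hc : 0 < c)
    (hg : (a.gcd b).gcd c = 1) (H : IsRelatedLShape a b c l h w y)
    (hB : IsBasicFactorization a b c l h w y m x₀ y₀ z₀)
    (hδ : (l : ℤ) * a - y * b = δ * c) (hθ : (h : ℤ) * b - w * a = θ * c) (S T : ℕ → ℤ)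
    (hS : ∀ k ≤ z₀ / (δ + θ), 0 ≤ S k ∧ ∀ e : ℤ, 0 ≤ e →
      (e ≤ S k ↔ e * y ≤ y₀ + k * ((h : ℤ) - y) ∧ e * δ ≤ z₀ - k * ((δ : ℤ) + θ)))
    (hT : ∀ k ≤ z₀ / (δ + θ), 0 ≤ T k ∧ ∀ e : ℤ, 0 ≤ e →
      (e ≤ T k ↔ e * w ≤ x₀ + k * ((l : ℤ) - w) ∧ e * θ ≤ z₀ - k * ((δ : ℤ) + θ))) :
    (denumerant m a b c : ℤ) = 1 + (z₀ / (δ + θ) : ℕ) +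
      ∑ k ∈ Finset.range (z₀ / (δ + θ) + 1), S k + ∑ k ∈ Finset.range (z₀ / (δ + θ) + 1), T k := by
  have hc' : (c : ℤ) ≠ 0 := by exact_mod_cast hc.ne'
  have area : (l : ℤ) * h = w * y + c := by exact_mod_cast H.area
  have hw := H.w_lt
  have hy := H.y_lt
  obtain ⟨ha', hb'⟩ := generators_eq hc' area hδ hθ
  have hpos : 0 < δ + θ := by
    by_contra hcon
    have h₁ : δ = 0 := by omega
    have h₂ : θ = 0 := by omega
    simp [h₁, h₂] at ha'
    omega
  obtain ⟨hm, hcell⟩ := hB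
  obtain ⟨hx₁, hy₁, hL⟩ := mem_cells.1 hcell
  have hm' : (x₀ : ℤ) * a + y₀ * b + z₀ * c = m := by exact_mod_cast hm
  set A := z₀ / (δ + θ) with hA
  -- A pair `(k, e)` encodes `α = k + max e 0` and `β = k + max (-e) 0`, that is, `k = min α β` and
  -- `e = α - β`.
  let X : (Σ _ : ℕ, ℤ) → ℤ := fun p => x₀ + ((p.1 + max p.2 0) * l - (p.1 + max (-p.2) 0) * w)
  let Y : (Σ _ : ℕ, ℤ) → ℤ := fun p => y₀ + ((p.1 + max (-p.2) 0) * h - (p.1 + max p.2 0) * y)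
  let Z : (Σ _ : ℕ, ℤ) → ℤ := fun p => z₀ - (p.1 + max p.2 0) * δ - (p.1 + max (-p.2) 0) * θ
  let F : Finset (Σ _ : ℕ, ℤ) := (Finset.range (A + 1)).sigma fun k => Finset.Icc (-T k) (S k)
  let φ : (Σ _ : ℕ, ℤ) → ℕ × ℕ × ℕ := fun p => ((X p).toNat, (Y p).toNat, (Z p).toNat)
  have hF : ∀ p : (Σ _ : ℕ, ℤ), p ∈ F ↔ p.1 ≤ A ∧ -T p.1 ≤ p.2 ∧ p.2 ≤ S p.1 := by
    intro p
    simp [F, Finset.mem_sigma]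
  have hnonneg : ∀ p ∈ F, 0 ≤ X p ∧ 0 ≤ Y p ∧ 0 ≤ Z p := by
    rintro ⟨k, e⟩ hp
    obtain ⟨hk, he₁, he₂⟩ := (hF _).1 hp
    simp only at hk he₁ he₂
    have hlw : (0 : ℤ) ≤ k * ((l : ℤ) - w) := mul_nonneg (by positivity) (by omega)
    have hhy : (0 : ℤ) ≤ k * ((h : ℤ) - y) := mul_nonneg (by positivity) (by omega)
    simp only [X, Y, Z]
    rcases le_or_gt 0 e with he | he
    · rw [max_eq_left he, max_eq_right (by omega)]
      obtain ⟨h₁, h₂⟩ := ((hS k hk).2 e he).1 he₂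
      have : (0 : ℤ) ≤ e * l := by positivity
      refine ⟨?_, ?_, ?_⟩ <;> linarith
    · rw [max_eq_right he.le, max_eq_left (by omega)]
      obtain ⟨h₁, h₂⟩ := ((hT k hk).2 (-e) (by omega)).1 (by omega)
      have : (0 : ℤ) ≤ -e * h := mul_nonneg (by omega) (by positivity)
      refine ⟨?_, ?_, ?_⟩ <;> linarith
  have himg : factorizations m a b c = (F.image φ : Finset _) := by
    ext ⟨x, t, z⟩
    simp only [factorizations, Set.mem_ofPred_eq, Finset.coe_image, Set.mem_image, Finset.mem_coe]
    constructor
    · intro hx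
      have hx' : (x : ℤ) * a + t * b + z * c = m := by exact_mod_cast hx
      obtain ⟨α, β, e₁, e₂⟩ := exists_coords hc hg area ⟨δ, by rw [hδ, mul_comm]⟩
        ⟨θ, by rw [hθ, mul_comm]⟩ (dx := (x : ℤ) - x₀) (dy := (t : ℤ) - y₀)
        ⟨z₀ - z, by linear_combination hx' - hm'⟩
      obtain ⟨hα, hβ⟩ := coords_nonneg (l := l) (h := h) (w := w) (y := y) (x₀ := x₀) (y₀ := y₀)
        (α := α) (β := β) (by omega) (by omega) (by omega) (by omega) (by omega) (by omega)
        (by omega) (by rw [← e₁]; omega) (by rw [← e₂]; omega)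
      have e₃ : (z : ℤ) = z₀ - α * δ - β * θ := by
        apply mul_left_cancel₀ hc'
        linear_combination hx' - hm' - a * e₁ - b * e₂ - α * hδ - β * hθ
      lift α to ℕ using hα
      lift β to ℕ using hβ
      have m₁ : ((min α β : ℕ) : ℤ) + max ((α : ℤ) - β) 0 = α := by omega
      have m₂ : ((min α β : ℕ) : ℤ) + max (-((α : ℤ) - β)) 0 = β := by omega
      have hz : (α : ℤ) * δ + β * θ ≤ z₀ := by omega
      have hk : min α β ≤ A := by
        rw [hA, Nat.le_div_iff_mul_le hpos]
        have h₁ : min α β * δ ≤ α * δ := Nat.mul_le_mul_right _ (min_le_left _ _)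
        have h₂ : min α β * θ ≤ β * θ := Nat.mul_le_mul_right _ (min_le_right _ _)
        have h₃ : α * δ + β * θ ≤ z₀ := by exact_mod_cast hz
        rw [mul_add]
        omega
      refine ⟨⟨min α β, (α : ℤ) - β⟩, (hF _).2 ⟨hk, ?_, ?_⟩, ?_⟩
      · simp only
        obtain ⟨hT₀, hT₁⟩ := hT _ hk
        rcases le_total α β with hle | hle
        · rw [min_eq_left hle] at hT₀ hT₁ ⊢
          have := (hT₁ ((β : ℤ) - α) (by omega)).2 ⟨by linarith, by linarith⟩
          linarith
        · have : (0 : ℤ) ≤ α - β := by omega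
          linarith
      · simp only
        obtain ⟨hS₀, hS₁⟩ := hS _ hk
        rcases le_total α β with hle | hle
        · have : (α : ℤ) - β ≤ 0 := by omega
          linarith
        · rw [min_eq_right hle] at hS₀ hS₁ ⊢
          exact (hS₁ ((α : ℤ) - β) (by omega)).2 ⟨by linarith, by linarith⟩
      · simp only [φ, X, Y, Z, m₁, m₂]
        rw [← e₁, ← e₂, ← e₃]
        simp
    · rintro ⟨p, hp, hpe⟩
      obtain ⟨h₁, h₂, h₃⟩ := hnonneg p hp
      simp only [φ, Prod.mk.injEq] at hpe
      obtain ⟨rfl, rfl, rfl⟩ := hpe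
      zify
      rw [Int.toNat_of_nonneg h₁, Int.toNat_of_nonneg h₂, Int.toNat_of_nonneg h₃]
      simp only [X, Y, Z]
      linear_combination hm' + (p.1 + max p.2 0) * hδ + (p.1 + max (-p.2) 0) * hθ
  have hinj : Set.InjOn φ F := by
    rintro ⟨k, e⟩ hp ⟨k', e'⟩ hp' heq
    obtain ⟨h₁, h₂, -⟩ := hnonneg _ hp
    obtain ⟨h₁', h₂', -⟩ := hnonneg _ hp'
    simp only [φ, Prod.mk.injEq] at heq
    have eX : X ⟨k, e⟩ = X ⟨k', e'⟩ := by omega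
    have eY : Y ⟨k, e⟩ = Y ⟨k', e'⟩ := by omega
    simp only [X, Y] at eX eY
    have hα : (k : ℤ) + max e 0 = k' + max e' 0 := by
      apply mul_left_cancel₀ hc'
      linear_combination h * eX + w * eY - (k + max e 0 - k' - max e' 0) * area
    have hβ : (k : ℤ) + max (-e) 0 = k' + max (-e') 0 := by
      apply mul_left_cancel₀ hc'
      linear_combination y * eX + l * eY - (k + max (-e) 0 - k' - max (-e') 0) * area
    obtain rfl : k = k' := by omega
    obtain rfl : e = e' := by omega
    rfl
  rw [denumerant, himg, Set.ncard_coe_finset, Finset.card_image_of_injOn hinj, Finset.card_sigma]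
  push_cast
  have : ∀ k ∈ Finset.range (A + 1), ((Finset.Icc (-T k) (S k)).card : ℤ) = 1 + S k + T k := by
    intro k hk
    have hk' : k ≤ A := Nat.lt_succ_iff.1 (Finset.mem_range.1 hk)
    have h₁ := (hS k hk').1
    have h₂ := (hT k hk').1
    rw [Int.card_Icc]
    omega
  rw [Finset.sum_congr rfl this, Finset.sum_add_distrib, Finset.sum_add_distrib]
  simp
  ring

/-! ## The basic sum -/

theorem sum_range_cast (n : ℕ) : ∑ k ∈ Finset.range n, (k : ℤ) = ((n : ℤ) - 1) * n / 2 := by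
  induction n with
  | zero => simp
  | succ n ih =>
    rw [Finset.sum_range_succ, ih]
    push_cast
    rw [add_sub_cancel_right, mul_comm (n : ℤ) (n + 1), triangle_succ, mul_comm ((n : ℤ) - 1)]

theorem add_mul_ediv_eq (p k r : ℤ) {w : ℤ} (hw : 0 < w) :
    (p + k * r) / w = p / w + k * (r / w) + (p % w + k * (r % w)) / w := by
  have := ediv_reduce p r k one_pos hw
  simp only [one_mul, Int.ediv_one] at this
  linarith

theorem sub_mul_ediv_eq (p k r : ℤ) {w : ℤ} (hw : 0 < w) :
    (p - k * r) / w = p / w - k * (r / w) + (p % w - k * (r % w)) / w := by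
  have := add_mul_ediv_eq p (-k) r hw
  simp only [neg_mul, ← sub_eq_add_neg] at this
  exact this

/-- Splitting off integer parts leaves parameters below the modulus, as the routine for `S⁺`
requires. -/
theorem sum_plus_half (p r : ℤ) {w : ℤ} (hw : 0 < w) (K : ℕ) :
    ∑ k ∈ Finset.range K, ((p + k * r) / w - k) =
      K * (p / w) + (r / w - 1) * (((K : ℤ) - 1) * K / 2) +
        ∑ k ∈ Finset.range K, (p % w + k * (r % w)) / w := by
  simp only [add_mul_ediv_eq p _ r hw, Finset.sum_sub_distrib, Finset.sum_add_distrib,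
    ← Finset.sum_mul, sum_range_cast, Finset.sum_const, Finset.card_range, nsmul_eq_mul]
  ring

/-- The tail starts at `K`, where the reduced numerator `z % d - K * (e % d)` may be negative or
large in size; it is therefore reduced modulo `d` a second time. -/
theorem sum_minus_half (z e : ℤ) {d : ℤ} (hd : 0 < d) (K n : ℕ) :
    ∑ j ∈ Finset.range n, ((z - (K + j : ℕ) * e) / d - (K + j : ℕ)) =
      n * (z / d) - (e / d + 1) *
        (((K + n : ℕ) - 1 : ℤ) * (K + n : ℕ) / 2 - ((K : ℤ) - 1) * K / 2) +
        n * ((z % d - K * (e % d)) / d) +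
        ∑ j ∈ Finset.range n, ((z % d - K * (e % d)) % d - j * (e % d)) / d := by
  have h₁ : ∀ j : ℕ, (z - (K + j : ℕ) * e) / d - (K + j : ℕ) = z / d -
      (K + j : ℕ) * (e / d + 1) + (z % d - K * (e % d)) / d +
      ((z % d - K * (e % d)) % d - j * (e % d)) / d := by
    intro j
    rw [sub_mul_ediv_eq z _ e hd]
    have h₂ := sub_mul_ediv_eq (z % d - K * (e % d)) j (e % d) hd
    rw [Int.ediv_eq_zero_of_lt (Int.emod_nonneg _ hd.ne') (Int.emod_lt_of_pos _ hd),
      Int.emod_emod] at h₂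
    rw [show z % d - (K + j : ℕ) * (e % d) = z % d - K * (e % d) - j * (e % d) by
      push_cast; ring, h₂]
    ring
  have h₃ : ∑ j ∈ Finset.range n, ((K + j : ℕ) : ℤ) =
      ((K + n : ℕ) - 1 : ℤ) * (K + n : ℕ) / 2 - ((K : ℤ) - 1) * K / 2 := by
    rw [← sum_range_cast, ← sum_range_cast, Finset.sum_range_add]
    ring
  simp only [h₁, Finset.sum_add_distrib, Finset.sum_sub_distrib, ← Finset.sum_mul, h₃,
    Finset.sum_const, Finset.card_range, nsmul_eq_mul]
  ring

/-- `S k` is the greatest `e` with `e width ≤ p₀ + k (side - width)` and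
`e dd ≤ z₀ - k (dd + ee)`. -/
def IsHalfSummand (p₀ side width dd ee z₀ : ℤ) (A : ℕ) (S : ℕ → ℤ) : Prop :=
  ∀ k ≤ A, 0 ≤ S k ∧ ∀ e : ℤ, 0 ≤ e →
    (e ≤ S k ↔ e * width ≤ p₀ + k * (side - width) ∧ e * dd ≤ z₀ - k * (dd + ee))

/-- Before `k₁` the first bound implies the second, and from `k₁` on the second implies the first.
Bounds without division make a zero `width` or `dd` harmless; `hA` makes `e = 0` admissible. -/
theorem isHalfSummand_of_split {p₀ side width dd ee z₀ : ℤ} {A : ℕ} (k₁ : ℤ) (hp : 0 ≤ p₀)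
    (hws : width < side) (hw : 0 ≤ width) (hd : 0 ≤ dd) (he : 0 ≤ ee) (hA : A * (dd + ee) ≤ z₀)
    (h₁ : ∀ k : ℕ, k ≤ A → (k : ℤ) < k₁ →
      0 < width ∧ (dd = 0 ∨ k * (side * dd + width * ee) < z₀ * width - p₀ * dd))
    (h₂ : ∀ k : ℕ, k ≤ A → k₁ ≤ k →
      0 < dd ∧ (width = 0 ∨ z₀ * width - p₀ * dd ≤ k * (side * dd + width * ee))) :
    IsHalfSummand p₀ side width dd ee z₀ A
      fun k => if (k : ℤ) < k₁ then (p₀ + k * side) / width - k else (z₀ - k * ee) / dd - k := by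
  intro k hk
  have hkA : (k : ℤ) * (dd + ee) ≤ z₀ :=
    le_trans (mul_le_mul_of_nonneg_right (by exact_mod_cast hk) (by linarith)) hA
  have hp' : 0 ≤ p₀ + k * (side - width) :=
    add_nonneg hp (mul_nonneg (by positivity) (by linarith))
  suffices h : ∀ e : ℤ, 0 ≤ e →
      (e ≤ (if (k : ℤ) < k₁ then (p₀ + k * side) / width - k else (z₀ - k * ee) / dd - k) ↔
        e * width ≤ p₀ + k * (side - width) ∧ e * dd ≤ z₀ - k * (dd + ee)) by
    refine ⟨(h 0 le_rfl).2 ⟨by linarith, by linarith⟩, h⟩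
  intro e he₀
  split_ifs with hlt
  · obtain ⟨hw₀, hor⟩ := h₁ k hk hlt
    rw [le_sub_iff_add_le, Int.le_ediv_iff_mul_le hw₀]
    constructor
    · intro h
      refine ⟨by linarith, ?_⟩
      rcases hor with hd₀ | hlt'
      · rw [hd₀] at hkA ⊢
        linarith
      · refine le_of_mul_le_mul_right ?_ hw₀
        have := mul_le_mul_of_nonneg_right h hd
        linarith
    · rintro ⟨h, -⟩
      linarith
  · obtain ⟨hd₀, hor⟩ := h₂ k hk (not_lt.1 hlt)
    rw [le_sub_iff_add_le, Int.le_ediv_iff_mul_le hd₀]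
    constructor
    · intro h
      refine ⟨?_, by linarith⟩
      rcases hor with hw₀ | hlt'
      · rw [hw₀] at hp' ⊢
        linarith
      · refine le_of_mul_le_mul_right ?_ hd₀
        have := mul_le_mul_of_nonneg_right h hw
        linarith
    · rintro ⟨-, h⟩
      linarith

/-- At most one `S⁺` and one `S⁻` are evaluated, with moduli `width` and `dd`, both at most `B`;
this accounts for `78 = 2 * 39`. -/
theorem wp_halfSum (σ : Store) (A B : ℕ) (hA : σ .am = A) (hp : 0 ≤ σ .p0)
    (hps : σ .p0 < σ .side) (hw : 0 ≤ σ .width) (hws : σ .width < σ .side) (hd : 0 ≤ σ .dd)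
    (he : 0 ≤ σ .ee) (hz : 0 ≤ σ .z0) (hgen : σ .gen = σ .side * σ .dd + σ .width * σ .ee)
    (hgen₀ : 0 < σ .gen) (hAz : A * (σ .dd + σ .ee) ≤ σ .z0) (hwB : σ .width ≤ B)
    (hdB : σ .dd ≤ B) :
    WP halfSum σ fun τ n =>
      (∃ S : ℕ → ℤ, IsHalfSummand (σ .p0) (σ .side) (σ .width) (σ .dd) (σ .ee) (σ .z0) A S ∧
        τ .part = ∑ k ∈ Finset.range (A + 1), S k) ∧ n ≤ 78 * B + 350 := by
  unfold halfSum
  refine WP.split 1 (WP.call (R := fun τ n => 0 ≤ τ .k1 ∧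
    (∀ k : ℕ, k ≤ A → (k : ℤ) < τ .k1 → 0 < σ .width ∧ (σ .dd = 0 ∨
      k * (σ .side * σ .dd + σ .width * σ .ee) < σ .z0 * σ .width - σ .p0 * σ .dd)) ∧
    (∀ k : ℕ, k ≤ A → τ .k1 ≤ k → 0 < σ .dd ∧ (σ .width = 0 ∨
      σ .z0 * σ .width - σ .p0 * σ .dd ≤ k * (σ .side * σ .dd + σ .width * σ .ee))) ∧ n ≤ 8)
    ?_ ?_)
  · simp only [List.take_succ_cons, List.take_zero]
    rw [wp_block_cons, wp_ite]
    simp only [wp_block_nil, Test.holds, Exp.eval_reg, Exp.eval_zero]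
    refine ⟨fun h => ?_, fun h => ?_⟩
    -- With `dd = 0` the second bound is vacuous in this range, so `k1` is placed beyond the last
    -- index. Then `width > 0`, since otherwise `gen` would vanish.
    · refine WP.call (R := fun τ n => τ .k1 = A + 1 ∧ n = 2) (by simp [hA]) ?_
      rintro τ _ ⟨hk, rfl⟩ -
      rw [hk]
      refine ⟨by omega, fun k _ _ => ⟨?_, .inl h⟩, fun k _ _ => by omega, by simp⟩
      refine lt_of_le_of_ne hw fun hw' => ?_
      rw [hgen, h, ← hw'] at hgen₀
      simp at hgen₀
    rw [wp_ite]
    simp only [Test.holds, Exp.eval_reg, Exp.eval_zero]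
    refine ⟨fun h' => ?_, fun h' => ?_⟩
    · refine WP.call (R := fun τ n => τ .k1 = 0 ∧ n = 1) (by simp) ?_
      rintro τ _ ⟨hk, rfl⟩ -
      rw [hk]
      exact ⟨le_rfl, fun k _ _ => by omega, fun k _ _ => ⟨by omega, .inl h'⟩, by simp⟩
    · refine WP.call (R := fun τ n =>
        τ .k1 = 0 - (σ .p0 * σ .dd - σ .z0 * σ .width) / σ .gen ∧ n = 6) (by simp) ?_
      rintro τ _ ⟨hk, rfl⟩ -
      -- `k1` is the ceiling of the point where the two linear bounds meet, found by clearing the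
      -- denominators `width` and `dd`. It is non-negative because `p0 < side` keeps that point
      -- above `-1`.
      have hiff : ∀ k : ℤ, τ .k1 ≤ k ↔
          σ .z0 * σ .width - σ .p0 * σ .dd ≤ k * (σ .side * σ .dd + σ .width * σ .ee) := by
        intro k
        rw [hk, zero_sub, show σ .p0 * σ .dd - σ .z0 * σ .width =
          -(σ .z0 * σ .width - σ .p0 * σ .dd) by ring, le_neg_ediv_neg_iff hgen₀, hgen, mul_comm k]
      refine ⟨?_, fun k _ hlt => ⟨by omega, .inr ?_⟩, fun k _ hle => ⟨by omega, .inr ?_⟩, by simp⟩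
      · by_contra hneg
        have h₁ := (hiff (-1)).1 (by omega)
        have h₂ : σ .p0 * σ .dd < σ .side * σ .dd := mul_lt_mul_of_pos_right hps (by omega)
        have h₃ : 0 ≤ σ .z0 * σ .width := by positivity
        have h₄ : 0 ≤ σ .width * σ .ee := by positivity
        linarith
      · rw [← not_le] at hlt ⊢
        exact fun h => hlt ((hiff k).2 h)
      · exact (hiff k).1 hle
  rintro τ n₀ ⟨hk₀, hk₁, hk₂, hn₀⟩ f
  have hS := isHalfSummand_of_split (τ .k1) hp hws hw hd he hAz hk₁ hk₂
  have fp : τ .p0 = σ .p0 := f _ rfl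
  have fs : τ .side = σ .side := f _ rfl
  have fw : τ .width = σ .width := f _ rfl
  have fd : τ .dd = σ .dd := f _ rfl
  have fe : τ .ee = σ .ee := f _ rfl
  have fz : τ .z0 = σ .z0 := f _ rfl
  have fA : τ .am = A := (f _ rfl).trans hA
  obtain ⟨K, hK⟩ : ∃ K : ℕ, τ .k1 = K := ⟨_, (Int.toNat_of_nonneg hk₀).symm⟩
  have hmodB : ∀ (r : ℤ) {q : ℤ}, 0 < q → q ≤ B → (r % q).toNat ≤ B := fun r q hq hqB => by
    have := Int.emod_lt_of_pos r hq
    omega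
  simp only [List.drop_succ_cons, List.drop_zero]
  rw [wp_block_cons, wp_ite]
  simp only [wp_block_nil, Test.holds, Exp.eval_reg, Exp.eval_zero]
  refine ⟨fun h => ?_, fun h => ?_⟩
  · have hd₀ : 0 < σ .dd := (hk₂ 0 (by omega) (by rw [h]; rfl)).1
    refine WP.split 4 (WP.call (R := fun υ n => υ .s = σ .z0 % σ .dd ∧ υ .t = σ .ee % σ .dd ∧
      υ .q = σ .dd ∧ υ .n = A ∧ n = 6) (by simp [fz, fd, fe, fA]) ?_)
    rintro τ₁ _ ⟨s₁, t₁, q₁, n₁, rfl⟩ f₁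
    simp only [List.drop_succ_cons, List.drop_zero, wp_block_cons, wp_block_nil]
    refine (wp_sMinus τ₁ (σ .ee % σ .dd).toNat A (by rw [s₁]; exact Int.emod_nonneg _ hd₀.ne')
      (by rw [s₁, q₁]; exact Int.emod_lt_of_pos _ hd₀)
      (by rw [t₁]; exact (Int.toNat_of_nonneg (Int.emod_nonneg _ hd₀.ne')).symm)
      (by rw [t₁, q₁]; exact Int.emod_lt_of_pos _ hd₀) n₁).call ?_
    rw [s₁, t₁, q₁]
    rintro τ₂ n₂ ⟨r₂, hn₂⟩ f₂
    refine WP.call (R := fun υ n => υ .part = (1 + A) * (σ .z0 / σ .dd) -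
      (σ .ee / σ .dd + 1) * (A * (1 + A) / 2) + τ₂ .res ∧ n = 12)
      (by simp [f₂ .am rfl, f₁ .am rfl, fA, f₂ .z0 rfl, f₁ .z0 rfl, fz, f₂ .dd rfl, f₁ .dd rfl, fd,
        f₂ .ee rfl, f₁ .ee rfl, fe]) ?_
    rintro τ₃ _ ⟨hpart, rfl⟩ -
    refine ⟨⟨_, hS, ?_⟩, by simp; have := hmodB (σ .ee) hd₀ hdB; omega⟩
    have hsum := sum_minus_half (σ .z0) (σ .ee) hd₀ 0 (A + 1)
    simp only [zero_add, Nat.cast_zero, zero_mul, mul_zero, sub_zero, Int.emod_emod,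
      Int.ediv_eq_zero_of_lt (Int.emod_nonneg (σ .z0) hd₀.ne') (Int.emod_lt_of_pos (σ .z0) hd₀),
      Int.zero_ediv, add_zero] at hsum
    rw [hpart, r₂, h]
    simp only [show ∀ k : ℕ, ¬ ((k : ℤ) < 0) from fun k => by omega, if_false]
    rw [hsum]
    push_cast
    rw [add_sub_cancel_right, add_comm (1 : ℤ)]
  rw [wp_ite]
  simp only [Test.holds, Exp.eval_reg]
  have hw₀ : 0 < σ .width := (hk₁ 0 (by omega) (by push_cast; omega)).1
  refine ⟨fun h' => ?_, fun h' => ?_⟩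
  · rw [hK, fA] at h'
    have hKA : K ≤ A := by exact_mod_cast h'
    have hK₁ : 1 ≤ K := by omega
    have hd₀ : 0 < σ .dd := (hk₂ A le_rfl (by rw [hK]; exact h')).1
    refine WP.split 4 (WP.call (R := fun υ n => υ .s = σ .p0 % σ .width ∧
      υ .t = σ .side % σ .width ∧ υ .q = σ .width ∧ υ .n = (K - 1 : ℕ) ∧ n = 7)
      (by simp [fp, fs, fw, hK, Nat.cast_sub hK₁]) ?_)
    rintro τ₁ _ ⟨s₁, t₁, q₁, n₁, rfl⟩ f₁
    simp only [List.drop_succ_cons, List.drop_zero]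
    rw [wp_block_cons]
    refine (wp_sPlus τ₁ (σ .side % σ .width).toNat (K - 1)
      (by rw [s₁]; exact Int.emod_nonneg _ hw₀.ne')
      (by rw [s₁, q₁]; exact Int.emod_lt_of_pos _ hw₀)
      (by rw [t₁]; exact (Int.toNat_of_nonneg (Int.emod_nonneg _ hw₀.ne')).symm)
      (by rw [t₁, q₁]; exact Int.emod_lt_of_pos _ hw₀) n₁).call ?_
    rw [s₁, t₁, q₁, show K - 1 + 1 = K by omega]
    rintro τ₂ n₂ ⟨r₂, hn₂⟩ f₂
    have gA : τ₂ .am = A := by rw [f₂ _ rfl, f₁ _ rfl, fA]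
    have gz : τ₂ .z0 = σ .z0 := by rw [f₂ _ rfl, f₁ _ rfl, fz]
    have gd : τ₂ .dd = σ .dd := by rw [f₂ _ rfl, f₁ _ rfl, fd]
    have ge : τ₂ .ee = σ .ee := by rw [f₂ _ rfl, f₁ _ rfl, fe]
    have gK : τ₂ .k1 = K := by rw [f₂ _ rfl, f₁ _ rfl, hK]
    have gp : τ₂ .p0 = σ .p0 := by rw [f₂ _ rfl, f₁ _ rfl, fp]
    have gs : τ₂ .side = σ .side := by rw [f₂ _ rfl, f₁ _ rfl, fs]
    have gw : τ₂ .width = σ .width := by rw [f₂ _ rfl, f₁ _ rfl, fw]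
    refine WP.split 2 (WP.call (R := fun υ n => υ .part = (1 + A) * (σ .z0 / σ .dd) -
      (σ .ee / σ .dd + 1) * (A * (1 + A) / 2) + K * (σ .p0 / σ .width - σ .z0 / σ .dd) +
      (σ .side / σ .width + σ .ee / σ .dd) * ((K - 1) * K / 2) + τ₂ .res ∧
      υ .alpha = σ .z0 % σ .dd - K * (σ .ee % σ .dd) ∧ n = 30)
      (by simp [gA, gz, gd, ge, gK, gp, gs, gw]) ?_)
    rintro τ₃ _ ⟨p₃, a₃, rfl⟩ f₃
    simp only [List.drop_succ_cons, List.drop_zero]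
    refine WP.split 4 (WP.call (R := fun υ n =>
      υ .s = (σ .z0 % σ .dd - K * (σ .ee % σ .dd)) % σ .dd ∧
      υ .t = σ .ee % σ .dd ∧ υ .q = σ .dd ∧ υ .n = (A - K : ℕ) ∧ n = 7)
      (by simp [a₃, f₃ .dd rfl, gd, f₃ .ee rfl, ge, f₃ .am rfl, gA, f₃ .k1 rfl, gK,
        Nat.cast_sub hKA]) ?_)
    rintro τ₄ _ ⟨s₄, t₄, q₄, n₄, rfl⟩ f₄
    simp only [List.drop_succ_cons, List.drop_zero, wp_block_cons, wp_block_nil]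
    refine (wp_sMinus τ₄ (σ .ee % σ .dd).toNat (A - K)
      (by rw [s₄]; exact Int.emod_nonneg _ hd₀.ne')
      (by rw [s₄, q₄]; exact Int.emod_lt_of_pos _ hd₀)
      (by rw [t₄]; exact (Int.toNat_of_nonneg (Int.emod_nonneg _ hd₀.ne')).symm)
      (by rw [t₄, q₄]; exact Int.emod_lt_of_pos _ hd₀) n₄).call ?_
    rw [s₄, t₄, q₄]
    rintro τ₅ n₅ ⟨r₅, hn₅⟩ f₅
    refine WP.call (R := fun υ n => υ .part = τ₃ .part +
      (σ .z0 % σ .dd - K * (σ .ee % σ .dd)) / σ .dd * (1 + A - K) + τ₅ .res ∧ n = 7)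
      (by simp [f₅ .part rfl, f₄ .part rfl, f₅ .alpha rfl, f₄ .alpha rfl, a₃, f₅ .dd rfl,
        f₄ .dd rfl, f₃ .dd rfl, gd, f₅ .am rfl, f₄ .am rfl, f₃ .am rfl, gA, f₅ .k1 rfl,
        f₄ .k1 rfl, f₃ .k1 rfl, gK]) ?_
    rintro τ₆ _ ⟨hpart, rfl⟩ -
    refine ⟨⟨_, hS, ?_⟩, by
      simp; have := hmodB (σ .ee) hd₀ hdB; have := hmodB (σ .side) hw₀ hwB; omega⟩
    have hsum := sum_minus_half (σ .z0) (σ .ee) hd₀ K (A - K + 1)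
    have hsum' := sum_plus_half (σ .p0) (σ .side) hw₀ K
    have hsplit : A + 1 = K + (A - K + 1) := by omega
    rw [← hsplit] at hsum
    have hfirst : ∀ k ∈ Finset.range K, (if (k : ℤ) < τ .k1 then
        (σ .p0 + k * σ .side) / σ .width - k else (σ .z0 - k * σ .ee) / σ .dd - k) =
        (σ .p0 + k * σ .side) / σ .width - k := fun k hk =>
      if_pos (by rw [hK]; exact_mod_cast Finset.mem_range.1 hk)
    have hsecond : ∀ j ∈ Finset.range (A - K + 1), (if ((K + j : ℕ) : ℤ) < τ .k1 then
        (σ .p0 + (K + j : ℕ) * σ .side) / σ .width - (K + j : ℕ) else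
        (σ .z0 - (K + j : ℕ) * σ .ee) / σ .dd - (K + j : ℕ)) =
        (σ .z0 - (K + j : ℕ) * σ .ee) / σ .dd - (K + j : ℕ) := fun j _ => if_neg (by omega)
    rw [hpart, p₃, r₂, r₅]
    conv_rhs => rw [hsplit, Finset.sum_range_add, Finset.sum_congr rfl hfirst,
      Finset.sum_congr rfl hsecond, hsum, hsum']
    push_cast [Nat.cast_sub hKA]
    rw [add_sub_cancel_right, add_comm (1 : ℤ) A]
    ring
  · rw [hK, fA] at h'
    have hKA : A < K := by exact_mod_cast not_le.1 h'
    refine WP.split 4 (WP.call (R := fun υ n => υ .s = σ .p0 % σ .width ∧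
      υ .t = σ .side % σ .width ∧ υ .q = σ .width ∧ υ .n = A ∧ n = 6)
      (by simp [fp, fs, fw, fA]) ?_)
    rintro τ₁ _ ⟨s₁, t₁, q₁, n₁, rfl⟩ f₁
    simp only [List.drop_succ_cons, List.drop_zero, wp_block_cons, wp_block_nil]
    refine (wp_sPlus τ₁ (σ .side % σ .width).toNat A
      (by rw [s₁]; exact Int.emod_nonneg _ hw₀.ne')
      (by rw [s₁, q₁]; exact Int.emod_lt_of_pos _ hw₀)
      (by rw [t₁]; exact (Int.toNat_of_nonneg (Int.emod_nonneg _ hw₀.ne')).symm)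
      (by rw [t₁, q₁]; exact Int.emod_lt_of_pos _ hw₀) n₁).call ?_
    rw [s₁, t₁, q₁]
    rintro τ₂ n₂ ⟨r₂, hn₂⟩ f₂
    refine WP.call (R := fun υ n => υ .part = (1 + A) * (σ .p0 / σ .width) +
      (σ .side / σ .width - 1) * (A * (1 + A) / 2) + τ₂ .res ∧ n = 12)
      (by simp [f₂ .am rfl, f₁ .am rfl, fA, f₂ .p0 rfl, f₁ .p0 rfl, fp, f₂ .width rfl,
        f₁ .width rfl, fw, f₂ .side rfl, f₁ .side rfl, fs]) ?_
    rintro τ₃ _ ⟨hpart, rfl⟩ -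
    refine ⟨⟨_, hS, ?_⟩, by simp; have := hmodB (σ .side) hw₀ hwB; omega⟩
    have hsum' := sum_plus_half (σ .p0) (σ .side) hw₀ (A + 1)
    rw [hpart, r₂, hK]
    rw [Finset.sum_congr rfl (fun k hk => if_pos (by
      have := Finset.mem_range.1 hk
      omega)), hsum']
    push_cast
    rw [add_sub_cancel_right, add_comm (1 : ℤ) A]

/-- The second phase computes the denumerant. -/
theorem wp_sumPhase {a b c l h w y m x₀ y₀ z₀ : ℕ} (ha : 0 < a) (hab : a < b) (hc : 0 < c)
    (hg : (a.gcd b).gcd c = 1) (H : IsRelatedLShape a b c l h w y)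
    (hB : IsBasicFactorization a b c l h w y m x₀ y₀ z₀) (σ : Store) (ea : σ .a = a)
    (eb : σ .b = b) (ec : σ .c = c) (el : σ .l = l) (eh : σ .h = h) (ew : σ .w = w)
    (ey : σ .y = y) (ex : σ .x0 = x₀) (eY : σ .y0 = y₀) (ez : σ .z0 = z₀) :
    WP sumPhase σ fun τ n => τ .out = denumerant m a b c ∧ n ≤ 156 * b + 800 := by
  obtain ⟨δ, θ, hδ, hθ⟩ := H.exists_delta_theta
  have hc' : (c : ℤ) ≠ 0 := by exact_mod_cast hc.ne'
  have area : (l : ℤ) * h = w * y + c := by exact_mod_cast H.area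
  obtain ⟨ha', hb'⟩ := generators_eq hc' area hδ hθ
  have ha'' : a = h * δ + y * θ := by exact_mod_cast ha'
  have hb'' : b = w * δ + l * θ := by exact_mod_cast hb'
  have hw := H.w_lt
  have hy := H.y_lt
  -- By `a = h δ + y θ` and `b = w δ + l θ`, all four moduli are at most `b`. If `θ = 0`, then `y <
  -- h ≤ a` is used instead of `y ≤ y θ`; similarly for `w` if `δ = 0`.
  have hδa : δ ≤ a := by
    have : δ ≤ h * δ := Nat.le_mul_of_pos_left _ (by omega)
    omega
  have hθb : θ ≤ b := by
    have : θ ≤ l * θ := Nat.le_mul_of_pos_left _ (by omega)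
    omega
  have hyb : y ≤ b := by
    rcases Nat.eq_zero_or_pos θ with rfl | hpos
    · have : 0 < δ := by
        by_contra hcon
        have : δ = 0 := by omega
        simp [this] at ha''
        omega
      have : h ≤ h * δ := Nat.le_mul_of_pos_right _ this
      omega
    · have : y ≤ y * θ := Nat.le_mul_of_pos_right _ hpos
      omega
  have hwb : w ≤ b := by
    rcases Nat.eq_zero_or_pos δ with rfl | hpos
    · have : 0 < θ := by
        by_contra hcon
        have : θ = 0 := by omega
        simp [this] at hb''
        omega
      have : l ≤ l * θ := Nat.le_mul_of_pos_right _ this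
      omega
    · have : w ≤ w * δ := Nat.le_mul_of_pos_right _ hpos
      omega
  have hAz : (z₀ / (δ + θ) : ℕ) * ((δ : ℤ) + θ) ≤ z₀ := by
    exact_mod_cast Nat.div_mul_le_self z₀ (δ + θ)
  obtain ⟨hx₁, hy₁, hL⟩ := mem_cells.1 hB.2
  unfold sumPhase
  rw [wp_ite]
  refine ⟨fun hneg => ?_, fun _ => ?_⟩
  · simp only [Test.holds, Exp.eval_reg, Exp.eval_zero, ez] at hneg
    omega
  refine WP.split 9 (WP.call (R := fun τ n => τ .delta = δ ∧ τ .theta = θ ∧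
    τ .am = (z₀ / (δ + θ) : ℕ) ∧ τ .p0 = y₀ ∧ τ .side = h ∧ τ .width = y ∧ τ .dd = δ ∧ τ .ee = θ ∧
    τ .gen = a ∧ n = 19) (by
      simp [ea, eb, ec, el, eh, ew, ey, eY, ez, hδ, hθ, Int.mul_ediv_cancel _ hc']) ?_)
  rintro τ _ ⟨d₁, t₁, am₁, p₁, s₁, w₁, dd₁, ee₁, g₁, rfl⟩ f
  simp only [List.drop_succ_cons, List.drop_zero]
  rw [wp_block_cons]
  refine (wp_halfSum τ (z₀ / (δ + θ)) b am₁ (by omega) (by omega) (by omega) (by omega)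
    (by omega) (by omega) (by rw [f _ rfl, ez]; omega) (by rw [g₁, s₁, dd₁, w₁, ee₁, ← ha'])
    (by omega) (by rw [dd₁, ee₁, f .z0 rfl, ez]; exact hAz) (by omega) (by omega)).call ?_
  rw [p₁, s₁, w₁, dd₁, ee₁, f .z0 rfl, ez]
  rintro τ₁ n₁ ⟨⟨S, hS, part₁⟩, hn₁⟩ f₁
  refine WP.split 7 (WP.call (R := fun τ n => τ .partY = τ₁ .part ∧ τ .p0 = x₀ ∧
    τ .side = l ∧ τ .width = w ∧ τ .dd = θ ∧ τ .ee = δ ∧ τ .gen = b ∧ n = 7) (by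
      simp [f₁ .x0 rfl, f .x0 rfl, ex, f₁ .l rfl, f .l rfl, el, f₁ .w rfl, f .w rfl, ew,
        f₁ .theta rfl, t₁, f₁ .delta rfl, d₁, f₁ .b rfl, f .b rfl, eb]) ?_)
  rintro τ₂ _ ⟨pY₂, p₂, s₂, w₂, dd₂, ee₂, g₂, rfl⟩ f₂
  simp only [List.drop_succ_cons, List.drop_zero, wp_block_cons, wp_block_nil]
  have z₂ : τ₂ .z0 = z₀ := by rw [f₂ _ rfl, f₁ _ rfl, f _ rfl, ez]
  have am₂ : τ₂ .am = (z₀ / (δ + θ) : ℕ) := by rw [f₂ _ rfl, f₁ _ rfl, am₁]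
  refine (wp_halfSum τ₂ (z₀ / (δ + θ)) b am₂ (by omega) (by omega) (by omega) (by omega)
    (by omega) (by omega) (by omega) (by rw [g₂, s₂, dd₂, w₂, ee₂, hb']; ring)
    (by omega) (by rw [dd₂, ee₂, z₂, add_comm (θ : ℤ)]; exact hAz) (by omega) (by omega)).call ?_
  rw [p₂, s₂, w₂, dd₂, ee₂, z₂]
  rintro τ₃ n₃ ⟨⟨T, hT, part₃⟩, hn₃⟩ f₃
  refine WP.call (R := fun τ n => τ .out = 1 + τ₃ .am + τ₃ .partY + τ₃ .part ∧ n = 4) (by simp) ?_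
  rintro τ₄ _ ⟨hout, rfl⟩ -
  refine ⟨?_, by simp; omega⟩
  rw [hout, f₃ .am rfl, am₂, f₃ .partY rfl, pY₂, part₁, part₃]
  refine (denumerant_eq_sum ha hc hg H hB hδ hθ S T hS ?_).symm
  intro k hk
  have := hT k hk
  rwa [add_comm (θ : ℤ)] at this

/-! ## The first phase -/

/-- The state of the first phase: `(l, -y)` and `(ex, fx)` form a basis of the lattice, the value of
`(l, -y)` is non-negative, and `(x₀, y₀)` is the square with the label of `m` in
`L(l, y + fx, l - ex, y)`. -/
structure Reduced (a b c m l y ex fx x₀ y₀ : ℤ) : Prop where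
  ex_pos : 0 < ex
  ex_le : ex ≤ l
  fx_pos : 0 < fx
  y_nonneg : 0 ≤ y
  area : l * fx + y * ex = c
  u_dvd : c ∣ l * a - y * b
  e_dvd : c ∣ ex * a + fx * b
  value : 0 ≤ l * a - y * b
  label : c ∣ x₀ * a + y₀ * b - m
  x_nonneg : 0 ≤ x₀
  x_lt : x₀ < l
  y₀_nonneg : 0 ≤ y₀
  y₀_lt : y₀ < y + fx
  corner : x₀ < ex ∨ y₀ < fx

/-- The effect of `advance`. -/
def IsAdvance (l y ex fx x₀ y₀ k l' y' x₀' y₀' : ℤ) : Prop :=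
  l' = l - k * ex ∧ y' = y + k * fx ∧ ∃ x₁ y₁ : ℤ,
    ((l - x₀ + ex - 1) / ex < k ∧ x₁ = x₀ - (l - (l - x₀ + ex - 1) / ex * ex) ∧
        y₁ = y₀ + (y + (l - x₀ + ex - 1) / ex * fx) ∨
      k ≤ (l - x₀ + ex - 1) / ex ∧ x₁ = x₀ ∧ y₁ = y₀) ∧
    x₀' = x₁ - x₁ / l' * l' ∧ y₀' = y₁ + x₁ / l' * y'

/-- The new basis results from the old one by two shears, so determinant and labels persist. The
point needs at most one subtraction of some `(l, -y) - j (ex, fx)` with `j < k`, followed by a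
division by the new `l'`. -/
theorem Reduced.advance {a b c m l y ex fx x₀ y₀ k l' y' x₀' y₀' : ℤ}
    (H : Reduced a b c m l y ex fx x₀ y₀) (hk : 0 ≤ k) (hl' : 0 < l')
    (hval : k * (ex * a + fx * b) ≤ l * a - y * b)
    (hadv : IsAdvance l y ex fx x₀ y₀ k l' y' x₀' y₀') :
    Reduced a b c m l' y' (ex - (ex - 1) / l' * l') (fx + (ex - 1) / l' * y') x₀' y₀' := by
  obtain ⟨el, ey, x₁, y₁, hcase, ex₀, ey₀⟩ := hadv
  have hex := H.ex_pos
  have hfx := H.fx_pos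
  have hy' : 0 ≤ y' := by
    rw [ey]
    exact add_nonneg H.y_nonneg (mul_nonneg hk hfx.le)
  have hQ₀ : 0 ≤ (ex - 1) / l' := Int.ediv_nonneg (by linarith) hl'.le
  have hQ₁ : l' * ((ex - 1) / l') ≤ ex - 1 := Int.mul_ediv_self_le hl'.ne'
  have hQ₂ : ex - 1 < l' * ((ex - 1) / l') + l' := Int.lt_mul_ediv_self_add hl'
  have hu : c ∣ l' * a - y' * b := by
    rw [el, ey, show (l - k * ex) * a - (y + k * fx) * b =
      (l * a - y * b) - k * (ex * a + fx * b) by ring]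
    exact dvd_sub H.u_dvd (H.e_dvd.mul_left _)
  set j := (l - x₀ + ex - 1) / ex with hj
  -- `j` is the ceiling of `(l - x₀) / ex`, the first index at which the vector is no wider than
  -- `x₀`. If `j < k`, then `x₀ ≥ ex`, and the corner condition yields `y₀ < fx`.
  have hj₁ : ex * j ≤ l - x₀ + ex - 1 := Int.mul_ediv_self_le hex.ne'
  have hj₂ : l - x₀ + ex - 1 < ex * j + ex := Int.lt_mul_ediv_self_add hex
  have hj₀ : 0 ≤ j := Int.ediv_nonneg (by linarith [H.x_lt]) hex.le
  have hpoint : 0 ≤ x₁ ∧ 0 ≤ y₁ ∧ c ∣ x₁ * a + y₁ * b - m ∧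
      (x₁ < ex ∧ y₁ < y' + fx ∨ x₁ < l' + ex ∧ y₁ < fx) := by
    have := H.x_nonneg
    have := H.y₀_nonneg
    have hy₀ := H.y_nonneg
    rcases hcase with ⟨hlt, rfl, rfl⟩ | ⟨hle, rfl, rfl⟩
    · have h₁ : (j + 1) * ex ≤ k * ex := mul_le_mul_of_nonneg_right (by linarith) hex.le
      have h₂ : (j + 1) * fx ≤ k * fx := mul_le_mul_of_nonneg_right (by linarith) hfx.le
      have h₃ : y₀ < fx := H.corner.resolve_left (by linarith)
      have h₄ : 0 ≤ j * fx := by positivity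
      refine ⟨by linarith, by linarith, ?_, .inl ⟨by linarith, by linarith⟩⟩
      rw [show (x₀ - (l - j * ex)) * a + (y₀ + (y + j * fx)) * b - m =
        (x₀ * a + y₀ * b - m) - (l * a - y * b) + j * (ex * a + fx * b) by ring]
      exact dvd_add (dvd_sub H.label H.u_dvd) (H.e_dvd.mul_left _)
    · have h₁ : k * ex ≤ j * ex := mul_le_mul_of_nonneg_right hle hex.le
      have h₂ : 0 ≤ k * fx := by positivity
      have h₃ := H.y₀_lt
      refine ⟨by linarith, by linarith, H.label, ?_⟩
      rcases H.corner with h | h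
      · exact .inl ⟨h, by linarith⟩
      · exact .inr ⟨by linarith, h⟩
  obtain ⟨hx₁, hy₁, hlab, hor⟩ := hpoint
  have hR₀ : 0 ≤ x₁ / l' := Int.ediv_nonneg hx₁ hl'.le
  have hR₁ : l' * (x₁ / l') ≤ x₁ := Int.mul_ediv_self_le hl'.ne'
  have hR₂ : x₁ < l' * (x₁ / l') + l' := Int.lt_mul_ediv_self_add hl'
  generalize x₁ / l' = R at *
  have hRmul : ∀ {Q' : ℤ}, R ≤ Q' → R * y' ≤ Q' * y' := fun h => mul_le_mul_of_nonneg_right h hy'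
  generalize (ex - 1) / l' = Q at *
  -- `Q` is the largest multiple keeping the new `ex` positive. If the quotient `R` attains its
  -- maximum, the new point lies left of the corner; otherwise it lies below it.
  have hcorner : y₀' < y' + (fx + Q * y') ∧ (x₀' < ex - Q * l' ∨ y₀' < fx + Q * y') := by
    rw [ex₀, ey₀]
    rcases hor with ⟨h₁, h₂⟩ | ⟨h₁, h₂⟩
    · have hle : R ≤ Q := by
        rw [← Int.lt_add_one_iff]
        exact lt_of_mul_lt_mul_left (by linarith : l' * R < l' * (Q + 1)) hl'.le
      rcases hle.eq_or_lt with rfl | hlt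
      · exact ⟨by linarith, .inl (by linarith)⟩
      · have := hRmul (Int.le_sub_one_of_lt hlt)
        exact ⟨by linarith, .inr (by linarith)⟩
    · have hle : R ≤ Q + 1 := by
        rw [← Int.lt_add_one_iff]
        exact lt_of_mul_lt_mul_left (by linarith : l' * R < l' * (Q + 1 + 1)) hl'.le
      rcases hle.eq_or_lt with rfl | hlt
      · exact ⟨by linarith, .inl (by linarith)⟩
      · have := hRmul (Int.lt_add_one_iff.1 hlt)
        exact ⟨by linarith, .inr (by linarith)⟩
  exact {
    ex_pos := by linarith
    ex_le := by linarith
    fx_pos := by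
      have : 0 ≤ Q * y' := by positivity
      linarith
    y_nonneg := hy'
    area := by
      rw [← H.area, el, ey]
      ring
    u_dvd := hu
    e_dvd := by
      rw [show (ex - Q * l') * a + (fx + Q * y') * b =
        (ex * a + fx * b) - Q * (l' * a - y' * b) by ring]
      exact dvd_sub H.e_dvd (hu.mul_left _)
    value := by
      rw [el, ey]
      linarith
    label := by
      rw [ex₀, ey₀, show (x₁ - R * l') * a + (y₁ + R * y') * b - m =
        (x₁ * a + y₁ * b - m) - R * (l' * a - y' * b) by ring]
      exact dvd_sub hlab (hu.mul_left _)
    x_nonneg := by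
      rw [ex₀]
      linarith
    x_lt := by
      rw [ex₀]
      linarith
    y₀_nonneg := by
      rw [ey₀]
      positivity
    y₀_lt := hcorner.1
    corner := hcorner.2 }

/-- The reduced basis from which the first phase starts. -/
theorem Reduced.initial {a b c m g L inv s₀ M : ℤ} (ha : 0 ≤ a) (hg : 0 < g) (hc : 0 < c)
    (hga : g ∣ a) (hL : g * L = c) (hinv : c ∣ inv * a - g) (hs₀ : g ∣ s₀ * b - 1)
    (hM : M = (m - m * s₀ % g * b) / g) :
    Reduced a b c m L 0 (L - b * inv % L) g (M * inv % L) (m * s₀ % g) := by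
  have hL₀ : 0 < L := by
    refine pos_of_mul_pos_right (a := g) ?_ hg.le
    rwa [hL]
  have hLa : c ∣ L * a := by
    obtain ⟨a', rfl⟩ := hga
    exact ⟨a', by rw [← hL]; ring⟩
  have hbl := Int.emod_lt_of_pos (b * inv) hL₀
  have hdiv : g ∣ m - m * s₀ % g * b := by
    rw [Int.emod_def, show m - (m * s₀ - g * (m * s₀ / g)) * b =
      g * (m * s₀ / g * b) - m * (s₀ * b - 1) by ring]
    exact dvd_sub (dvd_mul_right _ _) (hs₀.mul_left _)
  have hM' : g * M = m - m * s₀ % g * b := by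
    rw [hM]
    exact Int.mul_ediv_cancel' hdiv
  exact {
    ex_pos := by linarith
    ex_le := by linarith [Int.emod_nonneg (b * inv) hL₀.ne']
    fx_pos := hg
    y_nonneg := le_rfl
    area := by rw [← hL]; ring
    u_dvd := by simpa using hLa
    e_dvd := by
      rw [Int.emod_def, show (L - (b * inv - L * (b * inv / L))) * a + g * b =
        (1 + b * inv / L) * (L * a) - b * (inv * a - g) by ring]
      exact dvd_sub (hLa.mul_left _) (hinv.mul_left _)
    value := by
      rw [zero_mul, sub_zero]
      positivity
    label := by
      rw [show M * inv % L * a + m * s₀ % g * b - m = M * inv % L * a - g * M by rw [hM']; ring,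
        Int.emod_def, show (M * inv - L * (M * inv / L)) * a - g * M =
          M * (inv * a - g) - M * inv / L * (L * a) by ring]
      exact dvd_sub (hinv.mul_left _) (hLa.mul_left _)
    x_nonneg := Int.emod_nonneg _ hL₀.ne'
    x_lt := Int.emod_lt_of_pos _ hL₀
    y₀_nonneg := Int.emod_nonneg _ hg.ne'
    y₀_lt := by linarith [Int.emod_lt_of_pos (m * s₀) hg]
    corner := .inr (Int.emod_lt_of_pos _ hg) }

theorem wp_advance (σ : Store) : WP advance σ fun τ n =>
    IsAdvance (σ .l) (σ .y) (σ .ex) (σ .fx) (σ .x0) (σ .y0) (σ .k)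
      (τ .l) (τ .y) (τ .x0) (τ .y0) ∧ n ≤ 28 := by
  unfold advance
  rw [wp_block_cons]
  refine WP.call (R := fun τ n => τ .j1 = (σ .l - σ .x0 + σ .ex - 1) / σ .ex ∧ n = 5) (by simp) ?_
  rintro τ _ ⟨hj, rfl⟩ f
  rw [wp_block_cons]
  refine WP.call (R := fun υ n => (τ .j1 < σ .k ∧ υ .x0 = σ .x0 - (σ .l - τ .j1 * σ .ex) ∧
      υ .y0 = σ .y0 + (σ .y + τ .j1 * σ .fx) ∨
      σ .k ≤ τ .j1 ∧ υ .x0 = σ .x0 ∧ υ .y0 = σ .y0) ∧ n ≤ 9) ?_ ?_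
  · rw [wp_ite]
    simp only [Test.holds, Exp.eval_reg, f .k rfl]
    refine ⟨fun h => ?_, fun h => ?_⟩
    · simp [f .x0 rfl, f .l rfl, f .ex rfl, f .y0 rfl, f .y rfl, f .fx rfl, h]
    · simp [f .x0 rfl, f .y0 rfl, not_lt.1 h]
  rintro υ n ⟨hcase, hn⟩ f'
  refine WP.call (R := fun ρ n => ρ .l = υ .l - υ .k * υ .ex ∧ ρ .y = υ .y + υ .k * υ .fx ∧
    ρ .x0 = υ .x0 - υ .x0 / ρ .l * ρ .l ∧ ρ .y0 = υ .y0 + υ .x0 / ρ .l * ρ .y ∧ n = 14)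
    (by simp) ?_
  rintro ρ _ ⟨h₁, h₂, h₃, h₄, rfl⟩ -
  refine ⟨⟨?_, ?_, υ .x0, υ .y0, ?_, h₃, h₄⟩, by omega⟩
  · rw [h₁, f' .l rfl, f .l rfl, f' .k rfl, f .k rfl, f' .ex rfl, f .ex rfl]
  · rw [h₂, f' .y rfl, f .y rfl, f' .k rfl, f .k rfl, f' .fx rfl, f .fx rfl]
  · rwa [hj] at hcase

theorem wp_stepBounds (σ : Store) : WP stepBounds σ fun τ n =>
    τ .jn = (σ .l * σ .a - σ .y * σ .b) / (σ .ex * σ .a + σ .fx * σ .b) ∧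
    τ .jm = σ .l / σ .ex ∧ n = 10 := by
  simp [stepBounds]

/-- The invariant of the main loop of the first phase. -/
def ReductionInvariant (a b c m : ℤ) (σ : Store) : Prop :=
  σ .a = a ∧ σ .b = b ∧ σ .c = c ∧ σ .m = m ∧
    Reduced a b c m (σ .l) (σ .y) (σ .ex) (σ .fx) (σ .x0) (σ .y0) ∧
    σ .jn = (σ .l * a - σ .y * b) / (σ .ex * a + σ .fx * b) ∧ σ .jm = σ .l / σ .ex

/-- The new `l` is `l % ex` with `ex ≤ l`, hence at most half of the old one; this makes the number
of rounds logarithmic. -/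
theorem wp_reduction_loop {a b c m : ℤ} (ha : 0 < a) (hb : 0 < b) (k : ℕ) (σ : Store)
    (hσ : ReductionInvariant a b c m σ) (hk : σ .l < 2 ^ k) :
    WP (.loop (.le Reg.jm Reg.jn) (block [
      .k ≔ Reg.jm, advance,
      .quo ≔ (Reg.ex - 1) / Reg.l, .ex ≔ Reg.ex - Reg.quo * Reg.l, .fx ≔ Reg.fx + Reg.quo * Reg.y,
      stepBounds])) σ fun τ n =>
      ReductionInvariant a b c m τ ∧ τ .jn < τ .jm ∧ n ≤ 49 * k + 1 := by
  refine (wp_loop (fun k σ => ReductionInvariant a b c m σ ∧ σ .l < 2 ^ k) 48 ?_ k σ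
    ⟨hσ, hk⟩).call ?_
  · rintro k σ ⟨⟨ea, eb, ec, em, H, hjn, hjm⟩, hk⟩ hle
    simp only [Test.holds, Exp.eval_reg] at hle
    have hex := H.ex_pos
    have hfx := H.fx_pos
    have hval : 0 < σ .ex * a + σ .fx * b := by positivity
    have hjm₁ : 1 ≤ σ .jm := by
      rw [hjm, Int.le_ediv_iff_mul_le hex, one_mul]
      exact H.ex_le
    have hvle : σ .jm * (σ .ex * a + σ .fx * b) ≤ σ .l * a - σ .y * b := by
      rwa [hjn, Int.le_ediv_iff_mul_le hval] at hle
    have hmod : σ .l - σ .jm * σ .ex = σ .l % σ .ex := by rw [hjm, Int.emod_def, mul_comm]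
    -- A vanishing first coordinate would leave a vector with negative second coordinate, whose
    -- value is negative although the loop test makes it non-negative.
    have hl₀ : 0 < σ .l - σ .jm * σ .ex := by
      have h₁ : 0 < σ .y + σ .jm * σ .fx := by
        have := H.y_nonneg
        positivity
      have h₂ : 0 < (σ .y + σ .jm * σ .fx) * b := by positivity
      refine pos_of_mul_pos_left (b := a) ?_ ha.le
      linarith
    have hl₁ : 2 * (σ .l - σ .jm * σ .ex) ≤ σ .l := by
      have h₁ : σ .l - σ .jm * σ .ex < σ .ex := by rw [hmod]; exact Int.emod_lt_of_pos _ hex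
      have h₂ : 1 * σ .ex ≤ σ .jm * σ .ex := mul_le_mul_of_nonneg_right hjm₁ hex.le
      linarith
    obtain ⟨k', rfl⟩ : ∃ k', k = k' + 1 := by
      refine ⟨k - 1, ?_⟩
      rcases k with _ | k
      · simp at hk
        omega
      · rfl
    refine ⟨k', rfl, ?_⟩
    rw [wp_block_cons]
    refine WP.call (R := fun τ n => τ .k = σ .jm ∧ n = 1) (by simp) ?_
    rintro τ₁ _ ⟨k₁, rfl⟩ f₁
    rw [wp_block_cons]
    refine (wp_advance τ₁).call ?_
    rw [k₁, f₁ .l rfl, f₁ .y rfl, f₁ .ex rfl, f₁ .fx rfl, f₁ .x0 rfl, f₁ .y0 rfl]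
    rintro τ₂ n₂ ⟨hadv, hn₂⟩ f₂
    have l₂ : τ₂ .l = σ .l - σ .jm * σ .ex := hadv.1
    have H' := H.advance (by linarith) (by rw [l₂]; exact hl₀) hvle hadv
    refine WP.split 3 (WP.call (R := fun τ n => τ .ex = σ .ex - (σ .ex - 1) / τ₂ .l * τ₂ .l ∧
      τ .fx = σ .fx + (σ .ex - 1) / τ₂ .l * τ₂ .y ∧ n = 9)
      (by simp [f₂ .ex rfl, f₁ .ex rfl, f₂ .fx rfl, f₁ .fx rfl]) ?_)
    rintro τ₃ _ ⟨ex₃, fx₃, rfl⟩ f₃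
    simp only [List.drop_succ_cons, List.drop_zero, wp_block_cons, wp_block_nil]
    refine (wp_stepBounds τ₃).call ?_
    rintro τ₄ _ ⟨jn₄, jm₄, rfl⟩ f₄
    have a₃ : τ₃ .a = a := by rw [f₃ _ rfl, f₂ _ rfl, f₁ _ rfl, ea]
    have b₃ : τ₃ .b = b := by rw [f₃ _ rfl, f₂ _ rfl, f₁ _ rfl, eb]
    refine ⟨⟨⟨by rw [f₄ _ rfl, a₃], by rw [f₄ _ rfl, b₃],
      by rw [f₄ _ rfl, f₃ _ rfl, f₂ _ rfl, f₁ _ rfl, ec],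
      by rw [f₄ _ rfl, f₃ _ rfl, f₂ _ rfl, f₁ _ rfl, em], ?_, ?_, ?_⟩, ?_⟩, by omega⟩
    · rw [f₄ .l rfl, f₃ .l rfl, f₄ .y rfl, f₃ .y rfl, f₄ .ex rfl, ex₃, f₄ .fx rfl, fx₃, f₄ .x0 rfl,
        f₃ .x0 rfl, f₄ .y0 rfl, f₃ .y0 rfl]
      exact H'
    · rw [jn₄, f₄ .l rfl, f₄ .y rfl, f₄ .ex rfl, f₄ .fx rfl, a₃, b₃]
    · rw [jm₄, f₄ .l rfl, f₄ .ex rfl]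
    · rw [f₄ .l rfl, f₃ .l rfl, l₂]
      rw [pow_succ] at hk
      linarith
  · rintro τ n ⟨⟨-, hI, -⟩, hnot, hn⟩ -
    simp only [Test.holds, Exp.eval_reg, not_le] at hnot
    simp only [Test.cost, Exp.cost_reg] at hn
    exact ⟨hI, hnot, by omega⟩

/-- The first phase computes a related L-shape and the square in it with the label of `m`. -/
theorem wp_lShapePhase {a b c m k : ℕ} (ha : 0 < a) (hab : a < b) (hbc : b < c)
    (hg : (a.gcd b).gcd c = 1) (hk : c < 2 ^ k) (σ : Store) (ea : σ .a = a) (eb : σ .b = b)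
    (ec : σ .c = c) (em : σ .m = m) :
    WP lShapePhase σ fun τ n => ∃ l h w y x₀ y₀ : ℕ,
      τ .l = l ∧ τ .h = h ∧ τ .w = w ∧ τ .y = y ∧ τ .x0 = x₀ ∧ τ .y0 = y₀ ∧
      τ .z0 = ((m : ℤ) - x₀ * a - y₀ * b) / c ∧ (c : ℤ) ∣ x₀ * a + y₀ * b - m ∧
      IsRelatedLShape a b c l h w y ∧ (x₀, y₀) ∈ cells l h w y ∧ n ≤ 101 * k + 200 := by
  have hc : 0 < c := by omega
  have hsq : c * c < 2 ^ (2 * k) := by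
    rw [two_mul, pow_add]
    exact Nat.mul_lt_mul'' hk hk
  have hlog : ∀ {x z : ℕ}, x ≤ c → z ≤ c → (x : ℤ) * z < 2 ^ (2 * k) := by
    intro x z hx hz
    exact_mod_cast lt_of_le_of_lt (Nat.mul_le_mul hx hz) hsq
  unfold lShapePhase
  refine WP.split 2 (WP.call (R := fun τ n => τ .r0 = a ∧ τ .r1 = c ∧ n = 2)
    (by simp [ea, ec]) ?_)
  rintro τ₁ _ ⟨r₁, r₁', rfl⟩ f₁
  simp only [List.drop_succ_cons, List.drop_zero]
  rw [wp_block_cons]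
  refine (wp_euclid_log (2 * k) τ₁ (by omega) (by omega)
    (by rw [r₁, r₁']; exact hlog (by omega) le_rfl)).call ?_
  rw [r₁, r₁', Int.gcd_natCast_natCast]
  rintro τ₂ n₂ ⟨g₂, s₂, hn₂⟩ f₂
  rw [g₂] at s₂
  have hgpos : 0 < a.gcd c := Nat.gcd_pos_of_pos_left _ ha
  have hgle : a.gcd c ≤ a := Nat.gcd_le_left _ ha
  refine WP.split 8 (WP.call (R := fun τ n => τ .gac = a.gcd c ∧ τ .inv = τ₂ .s0 ∧
    τ .l = c / a.gcd c ∧ τ .y = 0 ∧ τ .ex = c / a.gcd c - b * τ₂ .s0 % (c / a.gcd c) ∧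
    τ .fx = a.gcd c ∧ τ .r0 = b ∧ τ .r1 = a.gcd c ∧ n = 12)
    (by simp [g₂, f₂ .c rfl, f₁ .c rfl, ec, f₂ .b rfl, f₁ .b rfl, eb]) ?_)
  rintro τ₃ _ ⟨gac₃, inv₃, l₃, y₃, ex₃, fx₃, r₃, r₃', rfl⟩ f₃
  simp only [List.drop_succ_cons, List.drop_zero]
  rw [wp_block_cons]
  refine (wp_euclid_log (2 * k) τ₃ (by omega) (by omega)
    (by rw [r₃, r₃']; exact hlog (by omega) (by omega))).call ?_
  rw [r₃, r₃', Int.gcd_natCast_natCast,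
    show b.gcd (a.gcd c) = 1 by rw [← Nat.gcd_assoc, Nat.gcd_comm b a, hg]]
  rintro τ₄ n₄ ⟨g₄, s₄, hn₄⟩ f₄
  rw [g₄] at s₄
  have m₄ : τ₄ .m = m := by rw [f₄ _ rfl, f₃ _ rfl, f₂ _ rfl, f₁ _ rfl, em]
  have b₄ : τ₄ .b = b := by rw [f₄ _ rfl, f₃ _ rfl, f₂ _ rfl, f₁ _ rfl, eb]
  refine WP.split 2 (WP.call (R := fun τ n => τ .y0 = m * τ₄ .s0 % a.gcd c ∧
    τ .x0 = (m - m * τ₄ .s0 % a.gcd c * b) / a.gcd c * τ₂ .s0 % (c / a.gcd c) ∧ n = 9)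
    (by simp [m₄, b₄, f₄ .gac rfl, gac₃, f₄ .inv rfl, inv₃, f₄ .l rfl, l₃]) ?_)
  rintro τ₅ _ ⟨y₅, x₅, rfl⟩ f₅
  simp only [List.drop_succ_cons, List.drop_zero]
  have hred := Reduced.initial (a := a) (b := b) (c := c) (m := m) (g := a.gcd c)
    (L := c / a.gcd c) (inv := τ₂ .s0) (s₀ := τ₄ .s0) (by positivity) (by exact_mod_cast hgpos)
    (by exact_mod_cast hc) (by exact_mod_cast Nat.gcd_dvd_left a c)
    (Int.mul_ediv_cancel' (by exact_mod_cast Nat.gcd_dvd_right a c)) s₂ s₄ rfl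
  have a₅ : τ₅ .a = a := by rw [f₅ _ rfl, f₄ _ rfl, f₃ _ rfl, f₂ _ rfl, f₁ _ rfl, ea]
  have b₅ : τ₅ .b = b := by rw [f₅ _ rfl, b₄]
  rw [wp_block_cons]
  refine (wp_stepBounds τ₅).call ?_
  rintro τ₆ _ ⟨jn₆, jm₆, rfl⟩ f₆
  rw [wp_block_cons]
  have hI : ReductionInvariant a b c m τ₆ := by
    refine ⟨by rw [f₆ _ rfl, a₅], by rw [f₆ _ rfl, b₅],
      by rw [f₆ _ rfl, f₅ _ rfl, f₄ _ rfl, f₃ _ rfl, f₂ _ rfl, f₁ _ rfl, ec],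
      by rw [f₆ _ rfl, f₅ _ rfl, m₄], ?_, ?_, ?_⟩
    · rw [f₆ .l rfl, f₅ .l rfl, f₄ .l rfl, l₃, f₆ .y rfl, f₅ .y rfl, f₄ .y rfl, y₃, f₆ .ex rfl,
        f₅ .ex rfl, f₄ .ex rfl, ex₃, f₆ .fx rfl, f₅ .fx rfl, f₄ .fx rfl, fx₃, f₆ .x0 rfl, x₅,
        f₆ .y0 rfl, y₅]
      exact hred
    · rw [jn₆, a₅, b₅, f₆ .l rfl, f₆ .y rfl, f₆ .ex rfl, f₆ .fx rfl]
    · rw [jm₆, f₆ .l rfl, f₆ .ex rfl]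
  have hl₆ : τ₆ .l < 2 ^ k := by
    rw [f₆ .l rfl, f₅ .l rfl, f₄ .l rfl, l₃]
    exact_mod_cast lt_of_le_of_lt (Nat.div_le_self _ _) hk
  refine (wp_reduction_loop (by exact_mod_cast ha) (by omega) k τ₆ hI hl₆).call ?_
  rintro τ₇ n₇ ⟨⟨a₇, b₇, c₇, m₇, H, hjn, hjm⟩, hlt, hn₇⟩ -
  rw [wp_block_cons]
  refine WP.call (R := fun τ n => τ .k = τ₇ .jn ∧ n = 1) (by simp) ?_
  rintro τ₈ _ ⟨k₈, rfl⟩ f₈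
  rw [wp_block_cons]
  refine (wp_advance τ₈).call ?_
  rw [k₈, f₈ .l rfl, f₈ .y rfl, f₈ .ex rfl, f₈ .fx rfl, f₈ .x0 rfl, f₈ .y0 rfl]
  rintro τ₉ n₉ ⟨hadv, hn₉⟩ f₉
  have hex := H.ex_pos
  have hfx := H.fx_pos
  have ha₀ : (0 : ℤ) < a := by exact_mod_cast ha
  have hb₀ : (0 : ℤ) < b := by omega
  have hval : 0 < τ₇ .ex * a + τ₇ .fx * b := by positivity
  have hjn₀ : 0 ≤ τ₇ .jn := by rw [hjn]; exact Int.ediv_nonneg H.value hval.le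
  have hjn₁ : τ₇ .jn * (τ₇ .ex * a + τ₇ .fx * b) ≤ τ₇ .l * a - τ₇ .y * b := by
    rw [hjn]; exact Int.ediv_mul_le _ hval.ne'
  have hjn₂ : τ₇ .l * a - τ₇ .y * b < (τ₇ .jn + 1) * (τ₇ .ex * a + τ₇ .fx * b) := by
    rw [hjn]; exact Int.lt_ediv_add_one_mul_self _ hval
  have l₉ := hadv.1
  have y₉ := hadv.2.1
  -- As `jn < jm`, one more step would still keep the first coordinate non-negative; thus `w = l -
  -- ex ≥ 0`. The second shear is then trivial.
  have hel : τ₇ .ex ≤ τ₉ .l := by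
    have : (τ₇ .jn + 1) * τ₇ .ex ≤ τ₇ .l := by
      rw [← Int.le_ediv_iff_mul_le hex, ← hjm]
      omega
    rw [l₉]
    linarith
  have H' := H.advance hjn₀ (by linarith) hjn₁ hadv
  have hQ : (τ₇ .ex - 1) / τ₉ .l = 0 := Int.ediv_eq_zero_of_lt (by linarith) (by linarith)
  rw [hQ, zero_mul, zero_mul, sub_zero, add_zero] at H'
  refine WP.call (R := fun τ n => τ .l = τ₉ .l ∧ τ .y = τ₉ .y ∧ τ .x0 = τ₉ .x0 ∧ τ .y0 = τ₉ .y0 ∧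
    τ .w = τ₉ .l - τ₇ .ex ∧ τ .h = τ₉ .y + τ₇ .fx ∧
    τ .z0 = (m - τ₉ .x0 * a - τ₉ .y0 * b) / c ∧ n = 10)
    (by simp [f₉ .ex rfl, f₈ .ex rfl, f₉ .fx rfl, f₈ .fx rfl, f₉ .m rfl, f₈ .m rfl, m₇, f₉ .a rfl,
      f₈ .a rfl, a₇, f₉ .b rfl, f₈ .b rfl, b₇, f₉ .c rfl, f₈ .c rfl, c₇]) ?_
  rintro τ _ ⟨el, ey, ex₀, ey₀, ew, eh, ez, rfl⟩ -
  have hy₀ := H'.y_nonneg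
  obtain ⟨l, hl⟩ := Int.eq_ofNat_of_zero_le (a := τ₉ .l) (by linarith)
  obtain ⟨y, hy⟩ := Int.eq_ofNat_of_zero_le (a := τ₉ .y) hy₀
  obtain ⟨x₀, hx₀⟩ := Int.eq_ofNat_of_zero_le (a := τ₉ .x0) H'.x_nonneg
  obtain ⟨y₀, hy₀'⟩ := Int.eq_ofNat_of_zero_le (a := τ₉ .y0) H'.y₀_nonneg
  obtain ⟨e, he⟩ := Int.eq_ofNat_of_zero_le (a := τ₇ .ex) hex.le
  obtain ⟨f, hf⟩ := Int.eq_ofNat_of_zero_le (a := τ₇ .fx) hfx.le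
  rw [hl, hy, hx₀, hy₀', he, hf] at H'
  have hel' : e ≤ l := by exact_mod_cast H'.ex_le
  have he₀ : 0 < e := by exact_mod_cast H'.ex_pos
  have hf₀ : 0 < f := by exact_mod_cast H'.fx_pos
  -- By maximality of `jn`, the value of the new `(l, -y)` is smaller than that of `(ex, fx)`; the
  -- difference is the value of `(-w, h)`.
  have hθ : ((l : ℤ) - e) * a ≤ (y + f) * b := by
    rw [← hl, ← hy, ← he, ← hf, l₉, y₉]
    linarith
  refine ⟨l, y + f, l - e, y, x₀, y₀, by rw [el, hl], by rw [eh, hy, hf]; push_cast; rfl,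
    by rw [ew, hl, he, Nat.cast_sub hel'], by rw [ey, hy], by rw [ex₀, hx₀], by rw [ey₀, hy₀'],
    by rw [ez, hx₀, hy₀'], H'.label, ?_, ?_, by omega⟩
  · refine isRelatedLShape_of_le hc hg (by omega) (by omega) ?_ ?_ ?_ ?_ ?_
    · zify [hel']
      linear_combination H'.area
    · apply Nat.ModEq.symm
      rw [Nat.modEq_iff_dvd]
      push_cast
      exact H'.u_dvd
    · apply Nat.ModEq.symm
      rw [Nat.modEq_iff_dvd]
      push_cast [Nat.cast_sub hel']
      rw [show ((y : ℤ) + f) * b - (l - e) * a = (e * a + f * b) - (l * a - y * b) by ring]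
      exact dvd_sub H'.e_dvd H'.u_dvd
    · have := H'.value
      zify
      linarith
    · zify [hel']
      exact hθ
  · rw [mem_cells]
    have h₁ : x₀ < l := by exact_mod_cast H'.x_lt
    have h₂ : y₀ < y + f := by exact_mod_cast H'.y₀_lt
    have h₃ : x₀ < e ∨ y₀ < f := by exact_mod_cast H'.corner
    omega

/-! ## The complete algorithm -/

theorem factorizations_nonempty_of_mem {m a b c : ℕ} (h : m ∈ semigroup a b c) :
    (factorizations m a b c).Nonempty := by
  unfold semigroup at h
  induction h using AddSubmonoid.closure_induction with
  | mem x hx =>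
    rcases hx with rfl | rfl | rfl
    · exact ⟨(1, 0, 0), by simp [factorizations]⟩
    · exact ⟨(0, 1, 0), by simp [factorizations]⟩
    · exact ⟨(0, 0, 1), by simp [factorizations]⟩
  | zero => exact ⟨(0, 0, 0), by simp [factorizations]⟩
  | add x y _ _ hx hy =>
    obtain ⟨p, hp⟩ := hx
    obtain ⟨r, hr⟩ := hy
    refine ⟨(p.1 + r.1, p.2.1 + r.2.1, p.2.2 + r.2.2), ?_⟩
    simp only [factorizations, Set.mem_ofPred_eq] at hp hr ⊢
    rw [← hp, ← hr]
    ring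

/-! ### Membership in the semigroup and the sign of the third coordinate -/

section BasicFactorization

variable {a b c l h w y m x₀ y₀ : ℕ}

theorem exists_basic_of_nonneg (hcell : (x₀, y₀) ∈ cells l h w y)
    (hlab : (c : ℤ) ∣ x₀ * a + y₀ * b - m) (hz : 0 ≤ ((m : ℤ) - x₀ * a - y₀ * b) / c) :
    ∃ z₀ : ℕ, ((m : ℤ) - x₀ * a - y₀ * b) / c = z₀ ∧
      IsBasicFactorization a b c l h w y m x₀ y₀ z₀ := by
  obtain ⟨z₀, hz₀⟩ := Int.eq_ofNat_of_zero_le hz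
  refine ⟨z₀, hz₀, ?_, hcell⟩
  have hdvd : (c : ℤ) ∣ m - x₀ * a - y₀ * b := by
    rw [show (m : ℤ) - x₀ * a - y₀ * b = -(x₀ * a + y₀ * b - m) by ring]
    exact hlab.neg_right
  have := Int.ediv_mul_cancel hdvd
  rw [hz₀] at this
  simp only [factorizations, Set.mem_ofPred_eq]
  zify
  linarith

/-- Any factorization has first two coordinates with the label of `m`, so by minimality the square
of the L-shape has value at most `m`. A negative `z₀` thus certifies that no factorization exists.
-/
theorem quotient_nonneg_of_nonempty (H : IsRelatedLShape a b c l h w y)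
    (hcell : (x₀, y₀) ∈ cells l h w y) (hlab : (c : ℤ) ∣ x₀ * a + y₀ * b - m)
    (hne : (factorizations m a b c).Nonempty) : 0 ≤ ((m : ℤ) - x₀ * a - y₀ * b) / c := by
  obtain ⟨⟨s, t, z⟩, hm⟩ := hne
  simp only [factorizations, Set.mem_ofPred_eq] at hm
  have hle := H.isMDD.minimal (x₀, y₀) hcell s t (by
    rw [Nat.modEq_iff_dvd]
    push_cast
    have hm' : (s : ℤ) * a + t * b + z * c = m := by exact_mod_cast hm
    rw [show (x₀ : ℤ) * a + y₀ * b - (s * a + t * b) = (x₀ * a + y₀ * b - m) + c * z by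
      rw [← hm']; ring]
    exact dvd_add hlab (dvd_mul_right _ _))
  refine Int.ediv_nonneg ?_ (by positivity)
  have hle' : (x₀ : ℤ) * a + y₀ * b ≤ m := by
    have : x₀ * a + y₀ * b ≤ m := by
      simp only at hle
      have := Nat.zero_le (z * c)
      omega
    exact_mod_cast this
  linarith

end BasicFactorization

theorem wp_algorithm {a b c m k : ℕ} (ha : 0 < a) (hab : a < b) (hbc : b < c)
    (hg : (a.gcd b).gcd c = 1) (hk : c < 2 ^ k) (σ : Store) (ea : σ .a = a) (eb : σ .b = b)
    (ec : σ .c = c) (em : σ .m = m) :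
    WP algorithm σ fun τ n =>
      τ .out = denumerant m a b c ∧ n ≤ (101 * k + 200) + (156 * b + 800) := by
  unfold algorithm
  simp only [wp_block_cons, wp_block_nil]
  refine (wp_lShapePhase ha hab hbc hg hk σ ea eb ec em).call ?_
  rintro τ n ⟨l, h, w, y, x₀, y₀, el, eh, ew, ey, ex, ey₀, ez, hlab, H, hcell, hn⟩ f
  rcases lt_or_ge (((m : ℤ) - x₀ * a - y₀ * b) / c) 0 with hneg | hnonneg
  · have hempty : denumerant m a b c = 0 := by
      have : factorizations m a b c = ∅ := by
        by_contra hne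
        have := quotient_nonneg_of_nonempty H hcell hlab (Set.nonempty_iff_ne_empty.2 hne)
        omega
      rw [denumerant, this, Set.ncard_empty]
    rw [← ez] at hneg
    unfold sumPhase
    rw [wp_ite]
    refine ⟨fun _ => ?_, fun hcon => absurd hneg hcon⟩
    refine WP.call (R := fun υ n => υ .out = 0 ∧ n = 1) (by simp) ?_
    rintro υ _ ⟨hout, rfl⟩ -
    exact ⟨by rw [hout, hempty]; rfl, by simp; omega⟩
  · obtain ⟨z₀, hz₀, hB⟩ := exists_basic_of_nonneg hcell hlab hnonneg
    refine (wp_sumPhase ha hab (by omega) hg H hB τ ((f _ rfl).trans ea) ((f _ rfl).trans eb)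
      ((f _ rfl).trans ec) el eh ew ey ex ey₀ (ez.trans hz₀)).call ?_
    rintro υ n' ⟨hout, hn'⟩ -
    exact ⟨hout, by omega⟩

/-! ### The absolute constant -/

theorem one_le_log_natCast {c : ℕ} (hc : 3 ≤ c) : 1 ≤ Real.log c := by
  rw [Real.le_log_iff_exp_le (by positivity)]
  have : (3 : ℝ) ≤ c := by exact_mod_cast hc
  linarith [Real.exp_one_lt_d9]

theorem natLog_two_le {c : ℕ} (hc : 3 ≤ c) : (Nat.log 2 c : ℝ) ≤ 2 * Real.log c := by
  have h₁ : ((2 : ℕ) : ℝ) ^ Nat.log 2 c ≤ c := by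
    exact_mod_cast Nat.pow_log_le_self 2 (by omega)
  have h₂ := Real.log_le_log (by positivity) h₁
  rw [Real.log_pow] at h₂
  push_cast at h₂
  have h₃ := Real.log_two_gt_d9
  have h₄ : (Nat.log 2 c : ℝ) * (1 / 2) ≤ Nat.log 2 c * Real.log 2 := by
    apply mul_le_mul_of_nonneg_left _ (by positivity)
    linarith
  linarith

end Denumerant

open Denumerant in
theorem theorem14 :
    ∃ C : ℝ,
      -- the complete algorithm
      (∀ a b c m : ℕ, 0 < a → a < b → b < c → (a.gcd b).gcd c = 1 →
        ∀ σ : Store, σ .a = a → σ .b = b → σ .c = c → σ .m = m →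
          ∃ (τ : Store) (n : ℕ), Exec algorithm σ τ n ∧
            τ .out = denumerant m a b c ∧
            (n : ℝ) ≤ C * (b + Real.log c)) ∧
      -- its first phase: the L-shape and the basic factorization
      (∀ a b c m : ℕ, 0 < a → a < b → b < c → (a.gcd b).gcd c = 1 →
        ∀ σ : Store, σ .a = a → σ .b = b → σ .c = c → σ .m = m →
          ∃ (τ : Store) (n l h w y : ℕ), Exec lShapePhase σ τ n ∧
            τ .l = l ∧ τ .h = h ∧ τ .w = w ∧ τ .y = y ∧
            IsRelatedLShape a b c l h w y ∧
            (m ∈ semigroup a b c → ∃ x₀ y₀ z₀ : ℕ,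
              τ .x0 = x₀ ∧ τ .y0 = y₀ ∧ τ .z0 = z₀ ∧
              IsBasicFactorization a b c l h w y m x₀ y₀ z₀) ∧
            (n : ℝ) ≤ C * Real.log c) ∧
      -- its second phase, with any related L-shape
      (∀ a b c m : ℕ, 0 < a → a < b → b < c → (a.gcd b).gcd c = 1 →
        ∀ l h w y x₀ y₀ z₀ : ℕ, IsRelatedLShape a b c l h w y →
          IsBasicFactorization a b c l h w y m x₀ y₀ z₀ →
          ∀ σ : Store, σ .a = a → σ .b = b → σ .c = c → σ .m = m →
            σ .l = l → σ .h = h → σ .w = w → σ .y = y →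
            σ .x0 = x₀ → σ .y0 = y₀ → σ .z0 = z₀ →
            ∃ (τ : Store) (n : ℕ), Exec sumPhase σ τ n ∧
              τ .out = denumerant m a b c ∧
              (n : ℝ) ≤ C * b) ∧
      -- a single discrete sum
      (∀ s t q N : ℕ, s < q → t < q →
        ∀ σ : Store, σ .s = s → σ .t = t → σ .q = q → σ .n = N →
          (∃ (τ : Store) (n : ℕ), Exec sPlus σ τ n ∧
            τ .res = ∑ k ∈ Finset.range (N + 1), ⌊((s : ℚ) + k * t) / q⌋ ∧
            (n : ℝ) ≤ C * (t + 1)) ∧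
          (∃ (τ : Store) (n : ℕ), Exec sMinus σ τ n ∧
            τ .res = ∑ k ∈ Finset.range (N + 1), ⌊((s : ℚ) - k * t) / q⌋ ∧
            (n : ℝ) ≤ C * (t + 1))) := by
  -- The hypotheses force `c ≥ 3` and `b ≥ 1`, so `log c ≥ 1` and `b` absorb the additive constants,
  -- giving at most `503 log c` and `956 b` for the two phases.
  refine ⟨1000, ?_, ?_, ?_, ?_⟩
  · intro a b c m ha hab hbc hg σ ea eb ec em
    obtain ⟨τ, n, he, hout, hn⟩ :=
      wp_algorithm ha hab hbc hg (Nat.lt_pow_succ_log_self one_lt_two c) σ ea eb ec em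
    refine ⟨τ, n, he, hout, ?_⟩
    have h₁ := one_le_log_natCast (c := c) (by omega)
    have h₂ := natLog_two_le (c := c) (by omega)
    have h₃ : (1 : ℝ) ≤ b := by exact_mod_cast (by omega : 1 ≤ b)
    have h₄ : (n : ℝ) ≤ (101 * (Nat.log 2 c + 1) + 200) + (156 * b + 800) := by exact_mod_cast hn
    linarith
  · intro a b c m ha hab hbc hg σ ea eb ec em
    obtain ⟨τ, n, he, l, h, w, y, x₀, y₀, el, eh, ew, ey, ex, ey₀, ez, hlab, H, hcell, hn⟩ :=
      wp_lShapePhase ha hab hbc hg (Nat.lt_pow_succ_log_self one_lt_two c) σ ea eb ec em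
    refine ⟨τ, n, l, h, w, y, he, el, eh, ew, ey, H, fun hm => ?_, ?_⟩
    · obtain ⟨z₀, hz₀, hB⟩ := exists_basic_of_nonneg hcell hlab
        (quotient_nonneg_of_nonempty H hcell hlab (factorizations_nonempty_of_mem hm))
      exact ⟨x₀, y₀, z₀, ex, ey₀, ez.trans hz₀, hB⟩
    · have h₁ := one_le_log_natCast (c := c) (by omega)
      have h₂ := natLog_two_le (c := c) (by omega)
      have h₄ : (n : ℝ) ≤ 101 * (Nat.log 2 c + 1) + 200 := by exact_mod_cast hn
      linarith
  · intro a b c m ha hab hbc hg l h w y x₀ y₀ z₀ H hB σ ea eb ec _ el eh ew ey ex ey₀ ez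
    obtain ⟨τ, n, he, hout, hn⟩ :=
      wp_sumPhase ha hab (by omega) hg H hB σ ea eb ec el eh ew ey ex ey₀ ez
    refine ⟨τ, n, he, hout, ?_⟩
    have h₃ : (1 : ℝ) ≤ b := by exact_mod_cast (by omega : 1 ≤ b)
    have h₄ : (n : ℝ) ≤ 156 * b + 800 := by exact_mod_cast hn
    linarith
  · intro s t q N hs ht σ es et eq en
    have ht₀ : (0 : ℝ) ≤ t := by positivity
    constructor
    · obtain ⟨τ, n, he, hres, hn⟩ := wp_sPlus σ t N (by omega) (by omega) et (by omega) en
      refine ⟨τ, n, he, ?_, ?_⟩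
      · rw [hres, es, et, eq]
        refine Finset.sum_congr rfl fun k _ => ?_
        rw [← Rat.floor_intCast_div_natCast]
        push_cast
        rfl
      · have h₄ : (n : ℝ) ≤ 39 * t + 110 := by exact_mod_cast hn
        linarith
    · obtain ⟨τ, n, he, hres, hn⟩ := wp_sMinus σ t N (by omega) (by omega) et (by omega) en
      refine ⟨τ, n, he, ?_, ?_⟩
      · rw [hres, es, et, eq]
        refine Finset.sum_congr rfl fun k _ => ?_
        rw [← Rat.floor_intCast_div_natCast]
        push_cast
        rfl
      · have h₄ : (n : ℝ) ≤ 39 * t + 120 := by exact_mod_cast hn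
        linarith
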